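/- **Theorem (the one-round protocol SumDP).** Throughout $\log=\log_2$; in the bounds below $\lg t:=\max(1,\log t)$. Let $\varepsilon>0$, $\delta>0$, $n\ge 1$, and let $U\ge1$ be a power of two. Users $i=1,\dots,n$ hold integers $x_i\in\{0,\dots,U\}$; $D=(x_1,\dots,x_n)$, $\mathrm{Sum}(D)=\sum_i x_i$, $\mathrm{Max}(D)=\max_i x_i$. *BaseSumDP* with domain bound $V$. Put $\lambda=0.1$, $\zeta=\min(0.1,0.1/\varepsilon)$, $B=\lceil V/\lceil\sqrt{n/\zeta}\,\rceil\rceil$, $\Delta=\lceil V/B\rceil$. On input $x\in\{0,\dots,V\}$ a user rounds $x/B$ to $x'=\lceil x/B\rceil-1$ with probability $\lceil x/B\rceil-x/B$ and to $x'=\lceil x/B\rceil$ otherwise, sends $x'$ if $x'\ne0$, and sends independent noise messages: $\mathrm{NB}(1/n,e^{-(1-\lambda)\varepsilon/\Delta})$ copies of $1$, as many (independently, with the same law) copies of $-1$, and for each zero-sum multiset $s$ among $\{1,-1\}$ (where $v=1$) and $\{v,-\lceil v/2\rceil,-\lfloor v/2\rfloor\}$, $\{-v,\lceil v/2\rceil,\lfloor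 v/2\rfloor\}$ for $2\le v\le\Delta$, $\mathrm{NB}(r/n,p_v)$ copies of $s$, where $r=3\bigl(1+\ln(2\Delta/\min(\delta,1))\bigr)$ and $p_v=\exp\bigl(-0.2\cdot\tfrac{\lambda\min(1,\varepsilon)}{2}\cdot\tfrac{v}{\Delta(\lceil\log\Delta\rceil+1)}\bigr)$. Here $\mathrm{NB}(r,p)$ is the law $k\mapsto\binom{k+r-1}{k}(1-p)^rp^k$ on $\mathbb Z_{\ge0}$. The analyzer returns $B$ times the sum of all the messages. *SumDP.* For $j=0,\dots,\log U$ let $I_0=[1,1]$ and $I_j=[2^{j-1}+1,2^j]$ for $j\ge1$. User $i$ runs, for each $j$, independently, the randomizer of BaseSumDP with domain bound $2^j$ on $x_i\cdot\mathbf 1(x_i\in I_j)$, and sends all the resulting messages, each tagged with its $j$. The shuffler hands the analyzer the multiset $R$ of all the messages of all users. Given $\beta>0$, the analyzer computes the BaseSumDP estimate $\tilde S_j$ from the messages with tag $j$, lets $\tau=2^j$ for the last $j$ with $\tilde S_j>1.3\cdot2^j\ln(2(\log U+1)/\beta)/\varepsilon$ ($\tau=0$ if there is none), and returns $\sum_{j:\,2^j\le\tau}\tilde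 S_j$. 1. *(Privacy.)* The multiset $R$ of messages received by the analyzer is $(\varepsilon,\delta)$-differentially private for the addition or removal of one element: for all $D,D'\in\{0,\dots,U\}^n$ that agree except at one user $i$, with $x_i=0$ or $x_i'=0$, and for every set $Y$, $\Pr[R(D)\in Y]\le e^{\varepsilon}\Pr[R(D')\in Y]+\delta$. For the replacement of one element by an arbitrary other one it is $(2\varepsilon,2\delta)$-differentially private. For every $\varepsilon_0>0$ there is a constant $C=C(\varepsilon_0)$ such that, whenever $\varepsilon\le\varepsilon_0$: 2. *(Error.)* For every $\beta>0$ and every $D\in\{0,\dots,U\}^n$, with probability at least $1-\beta$ the output differs from $\mathrm{Sum}(D)$ by at most $C\cdot\mathrm{Max}(D)\cdot\lg(\lg U/\beta)/\varepsilon$. 3. *(Communication.)* If $\delta\le1/n$, then for every input the expected number of messages that a user sends is at most $1+C\cdot\lg U\cdot\lg^2 n\cdot\lg(1/\delta)/(\varepsilon\sqrt n)$. Moreover (for every $\delta>0$) the messages that can be sent are encoded injectively by bit strings, with at most $C\min(\lg n,\lg U)$ bits for the BaseSumDP message and at most $C\lg\lg U$ bits for the tag $j$; if $\log U\le n$, the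 whole message has at most $C\min(\lg n,\lg U)$ bits. -/

import Mathlib

open scoped ENNReal

noncomputable section

namespace ShuffleSum

/-! ### Discrete distributions -/

/-- The coin that is `true` with probability `p`. -/
def coin (p : ℝ) (h0 : 0 ≤ p) (h1 : p ≤ 1) : PMF Bool :=
  PMF.ofFintype (fun b => if b then ENNReal.ofReal p else ENNReal.ofReal (1 - p)) (by
    simp only [Fintype.sum_bool, if_true, Bool.false_eq_true, if_false]
    rw [← ENNReal.ofReal_add h0 (by linarith)]
    simp)

/-- The weight of `k` under the negative binomial distribution with real shape `r` and
parameter `p`. -/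
def negBinomialReal (r p : ℝ) (k : ℕ) : ℝ :=
  Ring.choose (r + k - 1) k * (1 - p) ^ r * p ^ k

theorem choose_nonneg {r : ℝ} (hr : 0 ≤ r) (k : ℕ) : 0 ≤ Ring.choose (r + k - 1) k := by
  have h : Ring.choose (r + k - 1) k = Ring.multichoose r k := by
    rw [Ring.choose]; congr 1; ring
  rw [h]
  have h2 := Ring.factorial_nsmul_multichoose_eq_ascPochhammer r k
  rw [Polynomial.ascPochhammer_smeval_eq_eval, nsmul_eq_mul] at h2
  have h3 : 0 ≤ (ascPochhammer ℝ k).eval r := by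
    clear h h2
    induction k with
    | zero => simp
    | succ k ih =>
      rw [ascPochhammer_succ_eval]
      positivity
  have h4 : (0 : ℝ) < (k.factorial : ℝ) := by positivity
  by_contra hneg
  push Not at hneg
  nlinarith

theorem negBinomialReal_nonneg {r p : ℝ} (hr : 0 ≤ r) (hp0 : 0 ≤ p) (hp1 : p < 1) (k : ℕ) :
    0 ≤ negBinomialReal r p k := by
  have := choose_nonneg hr k
  have : 0 ≤ 1 - p := by linarith
  unfold negBinomialReal
  positivity

theorem negBinomialReal_hasSum {r p : ℝ} (hp0 : 0 ≤ p) (hp1 : p < 1) :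
    HasSum (negBinomialReal r p) 1 := by
  have h := (Real.one_div_one_sub_rpow_hasFPowerSeriesOnBall_zero r).hasSum
    (y := p) (by
      simp only [Metric.mem_eball, edist_zero_right]
      rw [← ofReal_norm, Real.norm_of_nonneg hp0]
      simpa using hp1)
  have hpos : 0 < (1 - p) ^ r := Real.rpow_pos_of_pos (by linarith) r
  have h' := h.mul_left ((1 - p) ^ r)
  simp only [zero_add] at h'
  rw [mul_one_div_cancel hpos.ne'] at h'
  refine h'.congr_fun fun k => ?_
  simp [negBinomialReal]
  ring

/-- The negative binomial distribution `NB(r, p)` on `ℕ`, with real shape `r ≥ 0` and `0 ≤ p < 1`: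
the weight of `k` is `binom(k + r - 1, k) (1 - p) ^ r p ^ k`. (Outside this range of parameters,
which is never used, it is set to the point mass at `0`.) -/
def negBinomial (r p : ℝ) : PMF ℕ :=
  open Classical in
  if h : 0 ≤ r ∧ 0 ≤ p ∧ p < 1 then
    ⟨fun k => ENNReal.ofReal (negBinomialReal r p k), by
      have h1 := negBinomialReal_hasSum (r := r) h.2.1 h.2.2
      have h2 := ENNReal.ofReal_tsum_of_nonneg
        (negBinomialReal_nonneg h.1 h.2.1 h.2.2) h1.summable
      rw [h1.tsum_eq, ENNReal.ofReal_one] at h2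
      rw [h2]
      exact ENNReal.summable.hasSum⟩
  else PMF.pure 0

/-- The union of independent random multisets with the given laws. -/
def indepUnion {α : Type} : List (PMF (Multiset α)) → PMF (Multiset α)
  | [] => PMF.pure 0
  | p :: ps => p.bind fun S => (indepUnion ps).map fun T => S + T

/-! ### The shuffle model and differential privacy -/

/-- What the analyzer receives in a one-round shuffle protocol: every user applies the randomizer
to its own input, with independent randomness, and the shuffler releases the multiset union of all
the messages. -/
def shuffled {X M : Type} {n : ℕ} (R : X → PMF (Multiset M)) (D : Fin n → X) :
    PMF (Multiset M) :=
  indepUnion (List.ofFn fun i => R (D i))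

/-- One direction of `(ε, δ)`-indistinguishability. -/
def Indist {Y : Type} (ε δ : ℝ) (p q : PMF Y) : Prop :=
  ∀ A : Set Y, p.toOuterMeasure A ≤
    ENNReal.ofReal (Real.exp ε) * q.toOuterMeasure A + ENNReal.ofReal δ

/-- `(ε, δ)`-differential privacy with respect to a (symmetric) neighboring relation. -/
def IsDP {X Y : Type} {n : ℕ} (nbr : (Fin n → X) → (Fin n → X) → Prop) (ε δ : ℝ)
    (M : (Fin n → X) → PMF Y) : Prop :=
  ∀ D D' : Fin n → X, nbr D D' → Indist ε δ (M D) (M D')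

/-- Addition or removal of one element: the datasets agree except for one user, and one of them
has no element (the value `0`) for this user. -/
def AddRemove {n U : ℕ} (D D' : Fin n → Fin (U + 1)) : Prop :=
  ∃ i, (∀ k, k ≠ i → D k = D' k) ∧ (D i = 0 ∨ D' i = 0)

/-- Replacement of one element: the datasets agree except for one user. -/
def Replace {n U : ℕ} (D D' : Fin n → Fin (U + 1)) : Prop :=
  ∃ i, ∀ k, k ≠ i → D k = D' k

/-! ### The protocol BaseSumDP -/

/-- The fixed share `λ` of the privacy budget that is spent on the flooding noise. -/
def lam : ℝ := 0.1

/-- The rounding parameter `ζ`. -/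
def zeta (ε : ℝ) : ℝ := min 0.1 (0.1 / ε)

/-- The width `B = ⌈U / √(n/ζ)⌉` of the rounding grid, where the domain size `√(n/ζ)` is
rounded up to an integer. If `U ≤ √(n/ζ)` then `B = 1` and nothing is rounded. -/
def gridWidth (ε : ℝ) (n U : ℕ) : ℕ :=
  ⌈(U : ℝ) / (⌈√((n : ℝ) / zeta ε)⌉₊ : ℝ)⌉₊

/-- The size `U'` of the domain after rounding to the grid: `U' = ⌈U / B⌉`. -/
def gridSize (ε : ℝ) (n U : ℕ) : ℕ := ⌈(U : ℝ) / (gridWidth ε n U : ℝ)⌉₊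

/-- Unbiased randomized rounding of `x / B` to one of the two neighboring integers. -/
def randRound (x B : ℕ) : PMF ℤ :=
  (coin ((⌈(x : ℝ) / B⌉ : ℝ) - (x : ℝ) / B)
    (by linarith [Int.le_ceil ((x : ℝ) / B)])
    (by linarith [Int.ceil_lt_add_one ((x : ℝ) / B)])).map
    fun down => if down then ⌈(x : ℝ) / B⌉ - 1 else ⌈(x : ℝ) / B⌉

/-- `k` copies of the multiset `s`, where `k` has law `p`. -/
def copies (p : PMF ℕ) (s : Multiset ℤ) : PMF (Multiset ℤ) := p.map fun k => k • s

/-- The parameter of the two central noises of all `n` users together, each of which is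
geometric: their difference is the discrete Laplace distribution of scale `Δ / ((1 - λ) ε)`. -/
def centralParam (ε : ℝ) (Δ : ℕ) : ℝ := Real.exp (-((1 - lam) * ε / Δ))

/-- The shape of the negative binomial flooding noises of all `n` users together. -/
def floodShape (δ : ℝ) (Δ : ℕ) : ℝ := 3 * (1 + Real.log (2 * Δ / min δ 1))

/-- The parameter of the flooding noise for the zero-sum multisets with largest element `v`. -/
def floodParam (ε : ℝ) (Δ v : ℕ) : ℝ :=
  Real.exp (-(0.2 * (lam * min 1 ε / 2) * v / (Δ * (Nat.clog 2 Δ + 1))))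

/-- The noise distribution `𝒫` on multisets of elements of `{-Δ, …, -1, 1, …, Δ}`, for one of `n`
users. It is the union of independent parts: the central noise, which consists of copies of `1` and
of `-1`, and the flooding noise, which consists of copies of the zero-sum multisets `{1, -1}`,
`{v, -⌈v/2⌉, -⌊v/2⌋}` and `{-v, ⌈v/2⌉, ⌊v/2⌋}` with `2 ≤ v ≤ Δ`. All the numbers of copies are
negative binomial, hence infinitely divisible, and a user draws a `1/n` share of them. -/
def noise (ε δ : ℝ) (n Δ : ℕ) : PMF (Multiset ℤ) :=
  indepUnion
    ([copies (negBinomial (1 / n) (centralParam ε Δ)) {1},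
      copies (negBinomial (1 / n) (centralParam ε Δ)) {-1},
      copies (negBinomial (floodShape δ Δ / n) (floodParam ε Δ 1)) {1, -1}] ++
    (List.range' 2 (Δ - 1)).flatMap fun v =>
      [copies (negBinomial (floodShape δ Δ / n) (floodParam ε Δ v))
        {(v : ℤ), -(((v + 1) / 2 : ℕ) : ℤ), -((v / 2 : ℕ) : ℤ)},
       copies (negBinomial (floodShape δ Δ / n) (floodParam ε Δ v))
        {-(v : ℤ), (((v + 1) / 2 : ℕ) : ℤ), ((v / 2 : ℕ) : ℤ)}])

/-- The randomizer of BaseSumDP on an input `x ∈ {0, …, U}`. -/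
def baseRandomizer (ε δ : ℝ) (n U x : ℕ) : PMF (Multiset ℤ) :=
  (randRound x (gridWidth ε n U)).bind fun y =>
    (noise ε δ n (gridSize ε n U)).map fun S => if y = 0 then S else y ::ₘ S

/-- The analyzer of BaseSumDP. -/
def baseAnalyzer (ε : ℝ) (n U : ℕ) (R : Multiset ℤ) : ℤ := R.sum * gridWidth ε n U

/-! ### The protocol SumDP -/

/-- Membership in the `j`-th dyadic sub-domain: `[1, 1]` if `j = 0`, and `[2^(j-1) + 1, 2^j]`
if `j ≥ 1`. -/
def InSubdomain (j x : ℕ) : Prop := (if j = 0 then 0 else 2 ^ (j - 1)) < x ∧ x ≤ 2 ^ j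

instance (j x : ℕ) : Decidable (InSubdomain j x) := by unfold InSubdomain; infer_instance

/-- A message of SumDP: the index of the sub-domain and a message of the BaseSumDP instance for
this sub-domain. -/
abbrev Msg : Type := ℕ × ℤ

/-- The randomizer of SumDP: for every sub-domain, the randomizer of BaseSumDP with domain bound
`2 ^ j` on the input `x · 𝟙(x in the sub-domain)`. -/
def sumRandomizer (ε δ : ℝ) (n U : ℕ) (x : Fin (U + 1)) : PMF (Multiset Msg) :=
  indepUnion ((List.range (Nat.log 2 U + 1)).map fun j =>
    (baseRandomizer ε δ n (2 ^ j) (if InSubdomain j x then x else 0)).map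
      fun S => S.map fun y => (j, y))

/-- The estimate of the sum over the `j`-th sub-domain. -/
def subEstimate (ε : ℝ) (n : ℕ) (R : Multiset Msg) (j : ℕ) : ℤ :=
  baseAnalyzer ε n (2 ^ j) ((R.filter fun m => m.1 = j).map Prod.snd)

open Classical in
/-- The clipping threshold `τ`: it is `2 ^ j` for the last `j` whose estimate passes the noisy test,
and `0` if there is none. -/
def clipThreshold (ε β : ℝ) (n U : ℕ) (R : Multiset Msg) : ℕ :=
  ((Finset.range (Nat.log 2 U + 1)).filter fun j =>
    (subEstimate ε n R j : ℝ) >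
      1.3 * 2 ^ j * Real.log (2 * (Real.logb 2 U + 1) / β) / ε).sup fun j => 2 ^ j

/-- The analyzer of SumDP: the sum of the estimates of the sub-domains up to `τ`. -/
def sumAnalyzer (ε β : ℝ) (n U : ℕ) (R : Multiset Msg) : ℤ :=
  ∑ j ∈ (Finset.range (Nat.log 2 U + 1)).filter (fun j => 2 ^ j ≤ clipThreshold ε β n U R),
    subEstimate ε n R j

/-! ### Quantities in the guarantees -/

/-- The true sum of a dataset. -/
def trueSum {n U : ℕ} (D : Fin n → Fin (U + 1)) : ℕ := ∑ i, (D i : ℕ)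

/-- The largest element of a dataset. -/
def maxElem {n U : ℕ} (D : Fin n → Fin (U + 1)) : ℕ := Finset.univ.sup fun i => (D i : ℕ)

/-- The binary logarithm in asymptotic bounds, bounded below by `1`. -/
def lg (t : ℝ) : ℝ := max 1 (Real.logb 2 t)

/-- The expected number of messages. -/
def expectedCard {α : Type} (p : PMF (Multiset α)) : ℝ≥0∞ := ∑' S, p S * (S.card : ℝ≥0∞)

/-- The messages that a user may send, on some input, with positive probability. -/
def sendable (ε δ : ℝ) (n U : ℕ) : Set Msg :=
  {m | ∃ x : Fin (U + 1), ∃ S ∈ (sumRandomizer ε δ n U x).support, m ∈ S}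

end ShuffleSum

end

open scoped ENNReal

noncomputable section

namespace ShuffleSum

/-! ### Convolution of discrete laws -/

section Convolution

variable {M N : Type} [AddCommMonoid M] [AddCommMonoid N]

/-- The laws on an additive commutative monoid form a commutative monoid under convolution: the
product of two laws is the law of the sum of two independent variables. -/
instance convMonoid : CommMonoid (PMF M) where
  mul p q := p.bind fun a => q.map fun b => a + b
  one := PMF.pure 0
  mul_assoc p q s := by
    change (p.bind fun a => q.map fun b => a + b).bind (fun c => s.map fun d => c + d) =
      p.bind fun a => (q.bind fun b => s.map fun c => b + c).map fun d => a + d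
    simp only [PMF.bind_bind, PMF.bind_map, PMF.map_bind, PMF.map_comp, Function.comp_def,
      add_assoc]
  one_mul p := by
    change (PMF.pure 0).bind (fun a => p.map fun b => a + b) = p
    simp only [PMF.pure_bind, zero_add]
    exact PMF.map_id p
  mul_one p := by
    change p.bind (fun a => (PMF.pure 0).map fun b => a + b) = p
    simp only [PMF.pure_map, add_zero, PMF.bind_pure]
  mul_comm p q := by
    change (p.bind fun a => q.map fun b => a + b) = q.bind fun a => p.map fun b => a + b
    simp only [← PMF.bind_pure_comp, Function.comp_def]
    rw [PMF.bind_comm]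
    simp only [add_comm]

theorem mul_def (p q : PMF M) : p * q = p.bind fun a => q.map fun b => a + b := rfl

theorem one_def : (1 : PMF M) = PMF.pure 0 := rfl

theorem pure_mul (a : M) (q : PMF M) : PMF.pure a * q = q.map fun b => a + b := by
  rw [mul_def, PMF.pure_bind]

theorem pure_mul_pure (a b : M) : PMF.pure a * PMF.pure b = PMF.pure (a + b) := by
  rw [pure_mul, PMF.pure_map]

theorem prod_pure {ι : Type*} (s : Finset ι) (f : ι → M) :
    ∏ i ∈ s, PMF.pure (f i) = PMF.pure (∑ i ∈ s, f i) := by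
  classical
  induction s using Finset.induction_on with
  | empty => simp [one_def]
  | insert i s hi ih => rw [Finset.prod_insert hi, Finset.sum_insert hi, ih, pure_mul_pure]

/-- The image of a law under an additive homomorphism, as a homomorphism of convolution monoids. -/
def mapHom (f : M →+ N) : PMF M →* PMF N where
  toFun p := p.map f
  map_one' := by rw [one_def, PMF.pure_map, map_zero]; rfl
  map_mul' p q := by
    simp only [mul_def, PMF.map_bind, PMF.bind_map, PMF.map_comp, Function.comp_def, map_add]

theorem mapHom_apply (f : M →+ N) (p : PMF M) : mapHom f p = p.map f := rfl

theorem map_eq_one {α : Type} {f : α → N} (p : PMF α) (hf : ∀ a, f a = 0) : p.map f = 1 := by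
  rw [show f = Function.const α 0 from funext hf, PMF.map_const]
  rfl

theorem bind_mul {α : Type} (p : PMF α) (f : α → PMF M) (q : PMF M) :
    p.bind f * q = p.bind fun a => f a * q := by
  simp only [mul_def, PMF.bind_bind]

theorem indepUnion_eq_prod {α : Type} (l : List (PMF (Multiset α))) : indepUnion l = l.prod := by
  induction l with
  | nil => rfl
  | cons p ps ih => rw [indepUnion, List.prod_cons, ← ih, mul_def]

theorem shuffled_eq_prod {X α : Type} {n : ℕ} (R : X → PMF (Multiset α)) (D : Fin n → X) :
    shuffled R D = ∏ i, R (D i) := by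
  rw [shuffled, indepUnion_eq_prod, List.prod_ofFn]

end Convolution

/-! ### Expectations -/

/-- The expectation of a nonnegative function. -/
def ev {α : Type} (p : PMF α) (f : α → ℝ≥0∞) : ℝ≥0∞ := ∑' a, p a * f a

section Expectation

variable {α β M : Type} [AddCommMonoid M]

theorem ev_pure (a : α) (f : α → ℝ≥0∞) : ev (PMF.pure a) f = f a := by
  rw [ev, tsum_eq_single a]
  · simp
  · intro b hb
    simp [PMF.pure_apply, hb]

theorem ev_bind (p : PMF α) (g : α → PMF β) (f : β → ℝ≥0∞) :
    ev (p.bind g) f = ev p fun a => ev (g a) f := by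
  simp only [ev, PMF.bind_apply, ← ENNReal.tsum_mul_right, ← ENNReal.tsum_mul_left]
  rw [ENNReal.tsum_comm]
  simp only [mul_assoc]

theorem ev_map (p : PMF α) (g : α → β) (f : β → ℝ≥0∞) :
    ev (p.map g) f = ev p fun a => f (g a) := by
  rw [← PMF.bind_pure_comp, ev_bind]
  simp only [Function.comp_def, ev_pure]

theorem ev_mul (p q : PMF M) (f : M → ℝ≥0∞) :
    ev (p * q) f = ev p fun a => ev q fun b => f (a + b) := by
  rw [mul_def, ev_bind]
  simp only [ev_map]

theorem ev_mono (p : PMF α) {f g : α → ℝ≥0∞} (h : ∀ a, f a ≤ g a) : ev p f ≤ ev p g :=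
  ENNReal.tsum_le_tsum fun a => by gcongr; exact h a

theorem ev_mono_support (p : PMF α) {f g : α → ℝ≥0∞} (h : ∀ a ∈ p.support, f a ≤ g a) :
    ev p f ≤ ev p g :=
  ENNReal.tsum_le_tsum fun a => by
    by_cases ha : a ∈ p.support
    · gcongr; exact h a ha
    · rw [PMF.mem_support_iff, not_not] at ha
      simp [ha]

theorem ev_const (p : PMF α) (c : ℝ≥0∞) : ev p (fun _ => c) = c := by
  rw [ev, ENNReal.tsum_mul_right, p.tsum_coe, one_mul]

theorem ev_add (p : PMF α) (f g : α → ℝ≥0∞) : ev p (fun a => f a + g a) = ev p f + ev p g := by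
  simp only [ev, mul_add, ENNReal.tsum_add]

theorem ev_const_mul (p : PMF α) (c : ℝ≥0∞) (f : α → ℝ≥0∞) :
    ev p (fun a => c * f a) = c * ev p f := by
  simp only [ev, ← ENNReal.tsum_mul_left, mul_left_comm]

theorem ev_le_one (p : PMF α) {f : α → ℝ≥0∞} (h : ∀ a, f a ≤ 1) : ev p f ≤ 1 :=
  (ev_mono p h).trans_eq (ev_const p 1)

theorem toOuterMeasure_eq_ev (p : PMF α) (A : Set α) :
    p.toOuterMeasure A = ev p (A.indicator fun _ => 1) := by
  rw [PMF.toOuterMeasure_apply, ev]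
  congr 1 with a
  by_cases h : a ∈ A <;> simp [h]

/-- The expectation of a multiplicative weight is multiplicative. -/
theorem ev_mul_of_map_add (p q : PMF M) {f : M → ℝ≥0∞} (hf : ∀ a b, f (a + b) = f a * f b) :
    ev (p * q) f = ev p f * ev q f := by
  simp only [ev_mul, hf, ev_const_mul]
  rw [mul_comm (ev p f), ← ev_const_mul]
  simp only [mul_comm]

theorem ev_prod_of_map_add {ι : Type*} (s : Finset ι) (p : ι → PMF M) {f : M → ℝ≥0∞}
    (h0 : f 0 = 1) (hf : ∀ a b, f (a + b) = f a * f b) :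
    ev (∏ i ∈ s, p i) f = ∏ i ∈ s, ev (p i) f := by
  classical
  induction s using Finset.induction_on with
  | empty => simp [one_def, ev_pure, h0]
  | insert i s hi ih =>
    rw [Finset.prod_insert hi, Finset.prod_insert hi, ev_mul_of_map_add _ _ hf, ih]

/-- The expectation of an additive weight is additive. -/
theorem ev_mul_of_additive (p q : PMF M) {f : M → ℝ≥0∞} (hf : ∀ a b, f (a + b) = f a + f b) :
    ev (p * q) f = ev p f + ev q f := by
  simp only [ev_mul, hf, ev_add, ev_const]

theorem ev_prod_of_additive {ι : Type*} (s : Finset ι) (p : ι → PMF M) {f : M → ℝ≥0∞}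
    (h0 : f 0 = 0) (hf : ∀ a b, f (a + b) = f a + f b) :
    ev (∏ i ∈ s, p i) f = ∑ i ∈ s, ev (p i) f := by
  classical
  induction s using Finset.induction_on with
  | empty => simp [one_def, ev_pure, h0]
  | insert i s hi ih =>
    rw [Finset.prod_insert hi, Finset.sum_insert hi, ev_mul_of_additive _ _ hf, ih]

/-- Markov's inequality. -/
theorem toOuterMeasure_le_of_le (p : PMF α) {A : Set α} {f : α → ℝ≥0∞} {c : ℝ≥0∞}
    (h : ∀ a ∈ A, 1 ≤ c * f a) : p.toOuterMeasure A ≤ c * ev p f := by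
  rw [toOuterMeasure_eq_ev, ← ev_const_mul]
  refine ev_mono p fun a => ?_
  by_cases ha : a ∈ A
  · simpa [ha] using h a ha
  · simp [ha]

theorem toOuterMeasure_compl (p : PMF α) (A : Set α) :
    p.toOuterMeasure A + p.toOuterMeasure Aᶜ = 1 := by
  rw [toOuterMeasure_eq_ev, toOuterMeasure_eq_ev, ← ev_add]
  refine Eq.trans ?_ (ev_const p 1)
  congr 1 with a
  by_cases ha : a ∈ A <;> simp [ha]

end Expectation

/-! ### Approximate indistinguishability -/

/-- Indistinguishability, tested on functions with values in the unit interval. -/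
def Close {α : Type} (ε : ℝ) (d : ℝ≥0∞) (p q : PMF α) : Prop :=
  ∀ f : α → ℝ≥0∞, (∀ a, f a ≤ 1) → ev p f ≤ ENNReal.ofReal (Real.exp ε) * ev q f + d

section Close

variable {α β M : Type} [AddCommMonoid M]

theorem Close.indist {ε δ : ℝ} {p q : PMF α} (h : Close ε (ENNReal.ofReal δ) p q) :
    Indist ε δ p q := by
  intro A
  rw [toOuterMeasure_eq_ev, toOuterMeasure_eq_ev]
  refine h _ fun a => ?_
  by_cases ha : a ∈ A <;> simp [ha]

theorem Close.refl (p : PMF α) : Close 0 0 p p := fun f _ => by simp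

theorem Close.mono {ε ε' : ℝ} {d d' : ℝ≥0∞} {p q : PMF α} (h : Close ε d p q) (hε : ε ≤ ε')
    (hd : d ≤ d') : Close ε' d' p q := fun f hf => (h f hf).trans (by gcongr)

theorem Close.map {ε : ℝ} {d : ℝ≥0∞} {p q : PMF α} (h : Close ε d p q) (g : α → β) :
    Close ε d (p.map g) (q.map g) := fun f hf => by
  rw [ev_map, ev_map]
  exact h _ fun a => hf _

theorem Close.of_map {ε : ℝ} {d : ℝ≥0∞} {p q : PMF α} {g : α → β} (hg : Function.Injective g)
    (h : Close ε d (p.map g) (q.map g)) : Close ε d p q := by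
  intro f hf
  have := h (Function.extend g f 0) fun b => by
    by_cases hb : ∃ a, g a = b
    · obtain ⟨a, rfl⟩ := hb
      rw [hg.extend_apply]
      exact hf a
    · rw [Function.extend_apply' _ _ _ hb]
      simp
  simpa only [ev_map, hg.extend_apply] using this

/-- Quasi-convexity. -/
theorem Close.bind {γ : Type} {ε : ℝ} {d : ℝ≥0∞} (p : PMF α) (p' : PMF β) {f : α → PMF γ}
    {g : β → PMF γ}
    (h : ∀ a ∈ p.support, ∀ b ∈ p'.support, Close ε d (f a) (g b)) :
    Close ε d (p.bind f) (p'.bind g) := by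
  intro F hF
  rw [ev_bind, ev_bind]
  have h1 : ∀ a ∈ p.support, ev (f a) F ≤
      ENNReal.ofReal (Real.exp ε) * (ev p' fun b => ev (g b) F) + d := by
    intro a ha
    have := ev_mono_support p' (f := fun _ => ev (f a) F)
      (g := fun b => ENNReal.ofReal (Real.exp ε) * ev (g b) F + d) fun b hb => h a ha b hb F hF
    rwa [ev_const, ev_add, ev_const, ev_const_mul] at this
  exact (ev_mono_support p h1).trans_eq (ev_const _ _)

/-- Basic composition. -/
theorem Close.mul {ε ε' : ℝ} {d d' : ℝ≥0∞} {p q p' q' : PMF M} (h : Close ε d p q)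
    (h' : Close ε' d' p' q') : Close (ε + ε') (d + d') (p * p') (q * q') := by
  intro f hf
  rw [ev_mul, ev_mul, Real.exp_add, ENNReal.ofReal_mul (Real.exp_pos _).le]
  set c := ENNReal.ofReal (Real.exp ε)
  set c' := ENNReal.ofReal (Real.exp ε')
  set g : M → ℝ≥0∞ := fun a => min 1 (c' * ev q' fun b => f (a + b)) with hg
  have h1 : ∀ a, (ev p' fun b => f (a + b)) ≤ g a + d' := by
    intro a
    have e1 := h' (fun b => f (a + b)) fun b => hf _
    have e2 : (ev p' fun b => f (a + b)) ≤ 1 := ev_le_one _ fun b => hf _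
    rcases le_total 1 (c' * ev q' fun b => f (a + b)) with h3 | h3
    · simp only [hg, min_eq_left h3]
      exact e2.trans le_self_add
    · simpa only [hg, min_eq_right h3] using e1
  calc (ev p fun a => ev p' fun b => f (a + b)) ≤ ev p fun a => g a + d' := ev_mono _ h1
    _ = ev p g + d' := by rw [ev_add, ev_const]
    _ ≤ c * ev q g + d + d' := by gcongr; exact h g fun a => min_le_left _ _
    _ ≤ c * (ev q fun a => c' * ev q' fun b => f (a + b)) + d + d' := by
      gcongr
      exact ev_mono _ fun a => min_le_right _ _
    _ = _ := by rw [ev_const_mul, ← mul_assoc, add_assoc]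

theorem Close.prod {ι : Type*} (s : Finset ι) {ε : ι → ℝ} {d : ι → ℝ≥0∞} {p q : ι → PMF M}
    (h : ∀ i ∈ s, Close (ε i) (d i) (p i) (q i)) :
    Close (∑ i ∈ s, ε i) (∑ i ∈ s, d i) (∏ i ∈ s, p i) (∏ i ∈ s, q i) := by
  classical
  induction s using Finset.induction_on with
  | empty => simpa using Close.refl (1 : PMF M)
  | insert i s hi ih =>
    rw [Finset.prod_insert hi, Finset.prod_insert hi, Finset.sum_insert hi, Finset.sum_insert hi]
    exact (h i (Finset.mem_insert_self i s)).mul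
      (ih fun j hj => h j (Finset.mem_insert_of_mem hj))

theorem Close.mul_left {ε : ℝ} {d : ℝ≥0∞} {p q : PMF M} (h : Close ε d p q) (r : PMF M) :
    Close ε d (r * p) (r * q) := by
  simpa using (Close.refl r).mul h

end Close

/-! ### The negative binomial distribution -/

theorem choose_eq_neg_choose (r : ℝ) (k : ℕ) :
    Ring.choose (r + k - 1) k = (-1) ^ k * Ring.choose (-r) k := by
  rw [Ring.choose_neg', Units.smul_def, zsmul_eq_mul, ← mul_assoc]
  rcases Nat.even_or_odd k with hk | hk <;> simp [hk, Ring.multichoose_eq]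

theorem factorial_mul_choose (r : ℝ) (m : ℕ) :
    (m.factorial : ℝ) * Ring.choose (r + m - 1) m = (ascPochhammer ℝ m).eval r := by
  rw [← Ring.multichoose_eq, ← nsmul_eq_mul,
    Ring.factorial_nsmul_multichoose_eq_ascPochhammer, Polynomial.ascPochhammer_smeval_eq_eval]

theorem choose_succ_mul (r : ℝ) (k : ℕ) :
    Ring.choose (r + (k + 1 : ℕ) - 1) (k + 1) * (k + 1) = Ring.choose (r + k - 1) k * (r + k) := by
  have h1 := factorial_mul_choose r (k + 1)
  rw [ascPochhammer_succ_eval, ← factorial_mul_choose r k, Nat.factorial_succ] at h1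
  have h2 : (k.factorial : ℝ) ≠ 0 := by positivity
  apply mul_left_cancel₀ h2
  push_cast at h1 ⊢
  linarith

theorem sum_choose_mul_choose (a b : ℝ) (k : ℕ) :
    ∑ ij ∈ Finset.HasAntidiagonal.antidiagonal k,
      Ring.choose (a + ij.1 - 1) ij.1 * Ring.choose (b + ij.2 - 1) ij.2 =
      Ring.choose (a + b + k - 1) k := by
  rw [choose_eq_neg_choose, neg_add, Ring.add_choose_eq k (Commute.all _ _), Finset.mul_sum]
  refine Finset.sum_congr rfl fun ij hij => ?_
  rw [choose_eq_neg_choose, choose_eq_neg_choose, ← Finset.HasAntidiagonal.mem_antidiagonal.1 hij, pow_add]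
  ring

theorem negBinomialReal_succ (r p : ℝ) (k : ℕ) :
    negBinomialReal r p (k + 1) * (k + 1) = negBinomialReal r p k * ((r + k) * p) := by
  have := choose_succ_mul r k
  unfold negBinomialReal
  rw [pow_succ]
  linear_combination (1 - p) ^ r * p ^ k * p * this

theorem sum_negBinomialReal_mul {p : ℝ} (hp1 : p < 1) (a b : ℝ) (k : ℕ) :
    ∑ ij ∈ Finset.HasAntidiagonal.antidiagonal k,
      negBinomialReal a p ij.1 * negBinomialReal b p ij.2 =
      negBinomialReal (a + b) p k := by
  rw [negBinomialReal, ← sum_choose_mul_choose, Finset.sum_mul, Finset.sum_mul]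
  refine Finset.sum_congr rfl fun ij hij => ?_
  rw [← Finset.HasAntidiagonal.mem_antidiagonal.1 hij, pow_add, Real.rpow_add (by linarith)]
  unfold negBinomialReal
  ring

theorem negBinomial_apply {r p : ℝ} (hr : 0 ≤ r) (hp0 : 0 ≤ p) (hp1 : p < 1) (k : ℕ) :
    negBinomial r p k = ENNReal.ofReal (negBinomialReal r p k) := by
  exact congrArg (fun q : PMF ℕ => q k) (dif_pos ⟨hr, hp0, hp1⟩)

theorem mul_apply_nat (p q : PMF ℕ) (k : ℕ) :
    (p * q) k = ∑ ij ∈ Finset.HasAntidiagonal.antidiagonal k,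
      p ij.1 * q ij.2 := by
  have h (a : ℕ) : (q.map fun b => a + b) k = if a ≤ k then q (k - a) else 0 := by
    rw [PMF.map_apply]
    split_ifs with hak
    · rw [tsum_eq_single (k - a), if_pos (by omega)]
      intro b hb
      rw [if_neg (by omega)]
    · simp only [show ∀ b, k ≠ a + b by omega, if_false, tsum_zero]
  rw [mul_def, PMF.bind_apply, Finset.Nat.sum_antidiagonal_eq_sum_range_succ (fun i j => p i * q j),
    tsum_eq_sum (s := Finset.range k.succ)]
  · refine Finset.sum_congr rfl fun a ha => ?_
    rw [h, if_pos (by simpa [Nat.lt_succ_iff] using ha)]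
  · intro a ha
    rw [h, if_neg (by simpa [Nat.lt_succ_iff] using ha), mul_zero]

theorem negBinomial_mul {a b p : ℝ} (ha : 0 ≤ a) (hb : 0 ≤ b) (hp0 : 0 ≤ p) (hp1 : p < 1) :
    negBinomial a p * negBinomial b p = negBinomial (a + b) p := by
  ext k
  rw [mul_apply_nat, negBinomial_apply (by positivity) hp0 hp1, ← sum_negBinomialReal_mul hp1,
    ENNReal.ofReal_sum_of_nonneg]
  · refine Finset.sum_congr rfl fun ij _ => ?_
    rw [negBinomial_apply ha hp0 hp1, negBinomial_apply hb hp0 hp1,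
      ENNReal.ofReal_mul (negBinomialReal_nonneg ha hp0 hp1 _)]
  · exact fun ij _ => mul_nonneg (negBinomialReal_nonneg ha hp0 hp1 _)
      (negBinomialReal_nonneg hb hp0 hp1 _)

/-- Infinite divisibility. -/
theorem negBinomial_div_pow {r p : ℝ} {n : ℕ} (hr : 0 ≤ r) (hp0 : 0 ≤ p) (hp1 : p < 1)
    (hn : 0 < n) : negBinomial (r / n) p ^ n = negBinomial r p := by
  have h (m : ℕ) : negBinomial (r / n) p ^ (m + 1) = negBinomial ((m + 1 : ℕ) * (r / n)) p := by
    induction m with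
    | zero => simp
    | succ m ih =>
      rw [pow_succ, ih, negBinomial_mul (by positivity) (by positivity) hp0 hp1]
      congr 1
      push_cast
      ring
  obtain ⟨m, rfl⟩ : ∃ m, n = m + 1 := ⟨n - 1, by omega⟩
  rw [h]
  congr 1
  field_simp

theorem negBinomialReal_one (p : ℝ) (k : ℕ) : negBinomialReal 1 p k = (1 - p) * p ^ k := by
  have : Ring.choose ((1 : ℝ) + k - 1) k = 1 := by
    rw [add_sub_cancel_left, Ring.choose_natCast]
    simp
  rw [negBinomialReal, this, Real.rpow_one, one_mul]

theorem negBinomialReal_le_succ {r p : ℝ} (hr : 1 ≤ r) (hp0 : 0 ≤ p) (hp1 : p < 1) (m : ℕ) :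
    p * negBinomialReal r p m ≤ negBinomialReal r p (m + 1) := by
  have h := negBinomialReal_succ r p m
  have h0 := negBinomialReal_nonneg (r := r) (by linarith) hp0 hp1 m
  have hm : (0 : ℝ) < m + 1 := by positivity
  refine le_of_mul_le_mul_right ?_ hm
  rw [h]
  have : p * negBinomialReal r p m * (m + 1) ≤ p * negBinomialReal r p m * (r + m) :=
    mul_le_mul_of_nonneg_left (by linarith) (by positivity)
  linarith

theorem negBinomialReal_le_add {r p : ℝ} (hr : 1 ≤ r) (hp0 : 0 ≤ p) (hp1 : p < 1) (m k : ℕ) :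
    p ^ k * negBinomialReal r p m ≤ negBinomialReal r p (m + k) := by
  induction k with
  | zero => simp
  | succ k ih =>
    refine le_trans ?_ (negBinomialReal_le_succ hr hp0 hp1 (m + k))
    rw [pow_succ, mul_comm (p ^ k), mul_assoc]
    gcongr

theorem negBinomialReal_add_le {r p T : ℝ} (hr : 1 ≤ r) (hp0 : 0 ≤ p) (hp1 : p < 1) (hT : 0 < T)
    (m k : ℕ) (hm : T ≤ m + 1) :
    negBinomialReal r p (m + k) ≤ (Real.exp ((r - 1) / T) * p) ^ k * negBinomialReal r p m := by
  induction k with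
  | zero => simp
  | succ k ih =>
    have h0 := negBinomialReal_nonneg (r := r) (by linarith) hp0 hp1 (m + k)
    have h := negBinomialReal_succ r p (m + k)
    have h1 : T ≤ ((m + k : ℕ) : ℝ) + 1 := by push_cast; linarith [k.cast_nonneg (α := ℝ)]
    have hm' : (0 : ℝ) < ((m + k : ℕ) : ℝ) + 1 := by linarith
    have h2 : r + ((m + k : ℕ) : ℝ) ≤ Real.exp ((r - 1) / T) * (((m + k : ℕ) : ℝ) + 1) := by
      have e1 := Real.add_one_le_exp ((r - 1) / T)
      have e2 : r - 1 ≤ (r - 1) / T * (((m + k : ℕ) : ℝ) + 1) := by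
        rw [div_mul_eq_mul_div, le_div_iff₀ hT]
        gcongr
      calc r + ((m + k : ℕ) : ℝ) ≤ ((r - 1) / T + 1) * (((m + k : ℕ) : ℝ) + 1) := by linarith
        _ ≤ _ := by gcongr
    rw [← add_assoc]
    calc negBinomialReal r p (m + k + 1)
        ≤ Real.exp ((r - 1) / T) * p * negBinomialReal r p (m + k) := by
          refine le_of_mul_le_mul_right ?_ hm'
          rw [h]
          calc _ = negBinomialReal r p (m + k) * p * (r + ((m + k : ℕ) : ℝ)) := by ring
            _ ≤ negBinomialReal r p (m + k) * p *
                (Real.exp ((r - 1) / T) * (((m + k : ℕ) : ℝ) + 1)) := by gcongr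
            _ = _ := by ring
      _ ≤ Real.exp ((r - 1) / T) * p *
          ((Real.exp ((r - 1) / T) * p) ^ k * negBinomialReal r p m) := by gcongr
      _ = _ := by ring

/-- The probability generating function of `NB(r, p)` at `p`. -/
theorem ev_negBinomial_pow {r p : ℝ} (hr : 0 ≤ r) (hp0 : 0 ≤ p) (hp1 : p < 1) :
    ev (negBinomial r p) (fun k => ENNReal.ofReal (p ^ k)) = ENNReal.ofReal ((1 + p) ^ (-r)) := by
  have hp2 : p ^ 2 < 1 := by nlinarith
  have hs := (negBinomialReal_hasSum (r := r) (sq_nonneg p) hp2).mul_left ((1 + p) ^ (-r))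
  have he (k : ℕ) : (1 + p) ^ (-r) * negBinomialReal r (p ^ 2) k =
      negBinomialReal r p k * p ^ k := by
    have : (1 - p ^ 2 : ℝ) ^ r = (1 - p) ^ r * (1 + p) ^ r := by
      rw [← Real.mul_rpow (by linarith) (by linarith)]
      congr 1
      ring
    rw [negBinomialReal, negBinomialReal, this, Real.rpow_neg (by linarith)]
    have : (1 + p) ^ r ≠ 0 := (Real.rpow_pos_of_pos (by linarith) r).ne'
    field_simp
    ring
  simp only [he] at hs
  rw [mul_one] at hs
  have h0 := negBinomialReal_nonneg hr hp0 hp1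
  rw [← hs.tsum_eq, ENNReal.ofReal_tsum_of_nonneg (fun k => mul_nonneg (h0 k) (by positivity))
    hs.summable, ev]
  congr 1 with k
  rw [negBinomial_apply hr hp0 hp1, ENNReal.ofReal_mul (h0 k)]

/-- The lower tail of the negative binomial distribution. -/
theorem negBinomial_lower_tail {r a T : ℝ} (hr : 0 ≤ r) (ha : 0 < a) :
    (negBinomial r (Real.exp (-a))).toOuterMeasure {k | (k : ℝ) < T} ≤
      ENNReal.ofReal (Real.exp (a * T) * (1 + Real.exp (-a)) ^ (-r)) := by
  rw [ENNReal.ofReal_mul (Real.exp_pos _).le,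
    ← ev_negBinomial_pow hr (Real.exp_pos _).le (by simpa using ha)]
  refine toOuterMeasure_le_of_le _ fun k hk => ?_
  rw [← ENNReal.ofReal_mul (Real.exp_pos _).le, ← Real.exp_nat_mul, ← Real.exp_add,
    ENNReal.one_le_ofReal]
  refine Real.one_le_exp ?_
  have : (k : ℝ) < T := hk
  nlinarith

/-! ### Shifts of the negative binomial distribution -/

/-- The negative binomial distribution, as a law on the integers. -/
def negBinomialInt (r p : ℝ) : PMF ℤ := (negBinomial r p).map Nat.cast

theorem ev_negBinomialInt (r p : ℝ) (f : ℤ → ℝ≥0∞) :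
    ev (negBinomialInt r p) f = ev (negBinomial r p) fun k => f k := ev_map _ _ _

theorem ev_shift_negBinomialInt (r p : ℝ) (c : ℤ) (f : ℤ → ℝ≥0∞) :
    ev (PMF.pure c * negBinomialInt r p) f = ev (negBinomial r p) fun k => f (c + k) := by
  rw [pure_mul, ev_map, ev_negBinomialInt]

theorem close_shift_nat {r a : ℝ} (hr : 1 ≤ r) (ha : 0 < a) (k : ℕ) :
    Close (a * k) 0 (PMF.pure (k : ℤ) * negBinomialInt r (Real.exp (-a)))
      (negBinomialInt r (Real.exp (-a))) := by
  intro f _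
  have hp1 : Real.exp (-a) < 1 := by simpa using ha
  have hp0 := (Real.exp_pos (-a)).le
  rw [ev_shift_negBinomialInt, ev_negBinomialInt, add_zero, ← ev_const_mul]
  simp only [ev, negBinomial_apply (zero_le_one.trans hr) hp0 hp1]
  have h (m : ℕ) : ENNReal.ofReal (negBinomialReal r (Real.exp (-a)) m) * f (k + m) ≤
      ENNReal.ofReal (negBinomialReal r (Real.exp (-a)) (m + k)) *
        (ENNReal.ofReal (Real.exp (a * k)) * f ((m + k : ℕ) : ℤ)) := by
    rw [← mul_assoc, ← ENNReal.ofReal_mul (negBinomialReal_nonneg (by linarith) hp0 hp1 _)]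
    push_cast
    rw [add_comm (k : ℤ)]
    gcongr
    have := negBinomialReal_le_add hr hp0 hp1 m k
    rw [← Real.exp_nat_mul] at this
    calc _ = Real.exp (k * -a) * negBinomialReal r (Real.exp (-a)) m * Real.exp (a * k) := by
          rw [mul_right_comm, ← Real.exp_add]; ring_nf; simp
      _ ≤ _ := by gcongr
  exact (ENNReal.tsum_le_tsum h).trans (ENNReal.tsum_comp_le_tsum_of_injective
    (f := fun m : ℕ => m + k) (fun x y hxy => by simpa using hxy) _)

theorem close_unshift_nat {r a : ℝ} (hr : 1 < r) (ha : 0 < a) (k : ℕ) (hk : 0 < k)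
    (hak : 5 * a * k ≤ 1) :
    Close (5 * a * k) (ENNReal.ofReal (Real.exp (1 - r / 3))) (negBinomialInt r (Real.exp (-a)))
      (PMF.pure (k : ℤ) * negBinomialInt r (Real.exp (-a))) := by
  intro f hf
  have hp1 : Real.exp (-a) < 1 := by simpa using ha
  have hp0 := (Real.exp_pos (-a)).le
  have hk' : (1 : ℝ) ≤ k := by exact_mod_cast hk
  set T : ℝ := (r - 1) / (6 * a) with hT
  have hTpos : 0 < T := by rw [hT]; apply div_pos <;> linarith
  rw [ev_shift_negBinomialInt, ev_negBinomialInt]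
  have tail : (negBinomial r (Real.exp (-a))).toOuterMeasure {m : ℕ | (m : ℝ) < T + k} ≤
      ENNReal.ofReal (Real.exp (1 - r / 3)) := by
    refine (negBinomial_lower_tail (by linarith) ha).trans (ENNReal.ofReal_le_ofReal ?_)
    have e1 : a * (T + k) ≤ r / 6 + 1 := by
      have : a * T = (r - 1) / 6 := by rw [hT]; field_simp
      nlinarith
    have e2 : Real.exp (1 / 2) ≤ 1 + Real.exp (-a) := by
      have h1 : Real.exp (1 / 2) ≤ 1.65 := by
        have : Real.exp (1 / 2) ^ 2 ≤ 1.65 ^ 2 := by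
          rw [← Real.exp_nat_mul]
          norm_num
          linarith [Real.exp_one_lt_d9]
        exact le_of_sq_le_sq this (by norm_num)
      have h2 : 1 - a ≤ Real.exp (-a) := Real.one_sub_le_exp_neg a
      nlinarith
    have e3 : (1 + Real.exp (-a)) ^ (-r) ≤ Real.exp (-(r / 2)) := by
      calc _ ≤ Real.exp (1 / 2) ^ (-r) :=
            Real.rpow_le_rpow_of_nonpos (Real.exp_pos _) e2 (by linarith)
        _ = _ := by rw [← Real.exp_mul]; ring_nf
    calc _ ≤ Real.exp (r / 6 + 1) * Real.exp (-(r / 2)) := by gcongr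
      _ = _ := by rw [← Real.exp_add]; ring_nf
  set A : Set ℕ := {m : ℕ | (m : ℝ) < T + k} with hA
  have split : ∀ m : ℕ, f (m : ℤ) ≤ A.indicator (fun _ => 1) m + Aᶜ.indicator (fun m => f m) m := by
    intro m
    by_cases hm : m ∈ A
    · simpa [hm] using hf m
    · simp [hm]
  refine (ev_mono _ split).trans ?_
  rw [ev_add, add_comm, ← toOuterMeasure_eq_ev]
  refine add_le_add ?_ tail
  rw [← ev_const_mul]
  simp only [ev, negBinomial_apply (zero_le_one.trans hr.le) hp0 hp1]
  have hsupp : Function.support (fun m : ℕ => ENNReal.ofReal (negBinomialReal r (Real.exp (-a)) m) *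
      Aᶜ.indicator (fun m : ℕ => f m) m) ⊆ Set.range fun m : ℕ => k + m := by
    intro m hm
    by_contra hcon
    apply hm
    have : m ∈ A := by
      have : m < k := by
        by_contra hkm
        exact hcon ⟨m - k, by simp only; omega⟩
      have : (m : ℝ) < k := by exact_mod_cast this
      change (m : ℝ) < T + k
      linarith
    simp [this]
  rw [← (add_right_injective k).tsum_eq hsupp]
  refine ENNReal.tsum_le_tsum fun m => ?_
  by_cases hm : k + m ∈ A
  · simp [hm]
  · rw [Set.indicator_of_mem (by exact hm), ← mul_assoc,
      ← ENNReal.ofReal_mul (negBinomialReal_nonneg (by linarith) hp0 hp1 _)]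
    push_cast
    gcongr
    have hm' : T ≤ m + 1 := by
      simp only [hA, Set.mem_ofPred_eq, not_lt, Nat.cast_add] at hm
      linarith
    have := negBinomialReal_add_le hr.le hp0 hp1 hTpos m k hm'
    rw [add_comm k, mul_comm (negBinomialReal _ _ m)]
    refine this.trans_eq ?_
    congr 1
    rw [← Real.exp_add, ← Real.exp_nat_mul]
    congr 1
    rw [hT]
    have : r - 1 ≠ 0 := by linarith
    field_simp
    ring

theorem close_shift {r a : ℝ} (hr : 1 < r) (ha : 0 < a) (k : ℤ) (hak : 5 * a * |(k : ℝ)| ≤ 1) :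
    Close (5 * a * |(k : ℝ)|) (ENNReal.ofReal (Real.exp (1 - r / 3)))
      (PMF.pure k * negBinomialInt r (Real.exp (-a))) (negBinomialInt r (Real.exp (-a))) := by
  rcases lt_trichotomy k 0 with hk | rfl | hk
  · obtain ⟨m, hm⟩ : ∃ m : ℕ, k = -m := ⟨k.natAbs, by omega⟩
    subst hm
    have h0 : |((-(m : ℤ) : ℤ) : ℝ)| = m := by simp
    rw [h0] at hak ⊢
    have := (close_unshift_nat hr ha m (by omega) hak).mul_left (PMF.pure (-(m : ℤ)))
    rwa [← mul_assoc, pure_mul_pure, neg_add_cancel, ← one_def, one_mul] at this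
  · rw [← one_def, one_mul]
    exact (Close.refl _).mono (by positivity) (by simp)
  · obtain ⟨m, rfl⟩ : ∃ m : ℕ, k = m := ⟨k.natAbs, by omega⟩
    refine (close_shift_nat hr.le ha m).mono ?_ (by simp)
    simp only [Int.cast_natCast, Nat.abs_cast]
    have : 0 ≤ a * m := by positivity
    linarith

/-! ### The total noise of all users -/

/-- The zero-sum multiset with leading element `w`: it is `{1, -1}` if `w = 1`, and
`{w, -⌈w/2⌉, -⌊w/2⌋}`, up to a common sign, if `2 ≤ |w|`. -/
def zeroSumSet (w : ℤ) : Multiset ℤ :=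
  if w = 1 then {1, -1}
  else {w, -(w.sign * (((w.natAbs + 1) / 2 : ℕ) : ℤ)), -(w.sign * ((w.natAbs / 2 : ℕ) : ℤ))}

/-- The leading elements of the zero-sum multisets. -/
def leaders (Δ : ℕ) : Finset ℤ := (Finset.Icc (-Δ : ℤ) Δ).filter fun w => w = 1 ∨ 2 ≤ |w|

theorem mem_leaders {Δ : ℕ} {w : ℤ} : w ∈ leaders Δ ↔ |w| ≤ Δ ∧ (w = 1 ∨ 2 ≤ |w|) := by
  rw [leaders, Finset.mem_filter, Finset.mem_Icc, abs_le]

theorem card_leaders_le (Δ : ℕ) : (leaders Δ).card ≤ 2 * Δ := by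
  have h : leaders Δ ⊆ (Finset.Icc (-Δ : ℤ) Δ).erase 0 := by
    intro w hw
    simp only [leaders, Finset.mem_filter] at hw
    refine Finset.mem_erase.2 ⟨?_, hw.1⟩
    rintro rfl
    simp at hw
  refine (Finset.card_le_card h).trans ?_
  rw [Finset.card_erase_of_mem (by simp), Int.card_Icc]
  omega

@[to_additive]
theorem prod_leaders {M : Type*} [CommMonoid M] {Δ : ℕ} (hΔ : 0 < Δ) (F : ℤ → M) :
    ∏ w ∈ leaders Δ, F w = F 1 * ∏ v ∈ Finset.Ico 2 (Δ + 1), (F v * F (-v)) := by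
  have h : leaders Δ = insert 1 ((Finset.Ico 2 (Δ + 1)).image (fun v : ℕ => (v : ℤ)) ∪
      (Finset.Ico 2 (Δ + 1)).image fun v : ℕ => -(v : ℤ)) := by
    ext w
    simp only [mem_leaders, Finset.mem_insert, Finset.mem_union, Finset.mem_image, Finset.mem_Ico]
    constructor
    · rintro ⟨h1, h2 | h2⟩
      · exact Or.inl h2
      · right
        rcases le_total 0 w with hw | hw
        · rw [abs_of_nonneg hw] at h1 h2
          exact Or.inl ⟨w.natAbs, by omega, by omega⟩
        · rw [abs_of_nonpos hw] at h1 h2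
          exact Or.inr ⟨w.natAbs, by omega, by omega⟩
    · rintro (rfl | ⟨v, hv, rfl⟩ | ⟨v, hv, rfl⟩)
      · simp; omega
      · simp; omega
      · simp; omega
  rw [h, Finset.prod_insert, Finset.prod_union, Finset.prod_image, Finset.prod_image,
    Finset.prod_mul_distrib]
  · intro x _ y _ hxy; simpa using hxy
  · intro x _ y _ hxy; simpa using hxy
  · rw [Finset.disjoint_left]
    simp only [Finset.mem_image, Finset.mem_Ico]
    rintro _ ⟨v, hv, rfl⟩ ⟨v', hv', h⟩
    omega
  · simp only [Finset.mem_union, Finset.mem_image, Finset.mem_Ico]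
    rintro (⟨v, hv, h⟩ | ⟨v, hv, h⟩) <;> omega

/-- The union of independent central and flooding noises, with a share of `1/n`. -/
def noiseProd (ε δ : ℝ) (n : ℝ) (Δ : ℕ) : PMF (Multiset ℤ) :=
  copies (negBinomial (1 / n) (centralParam ε Δ)) {1} *
    copies (negBinomial (1 / n) (centralParam ε Δ)) {-1} *
    ∏ w ∈ leaders Δ, copies (negBinomial (floodShape δ Δ / n) (floodParam ε Δ w.natAbs))
      (zeroSumSet w)

theorem prod_flatMap {α M : Type*} [Monoid M] (l : List α) (f : α → List M) :
    (l.flatMap f).prod = (l.map fun a => (f a).prod).prod := by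
  induction l with
  | nil => rfl
  | cons a l ih => rw [List.flatMap_cons, List.prod_append, ih, List.map_cons, List.prod_cons]

theorem prod_map_range {M : Type*} [CommMonoid M] (f : ℕ → M) (n : ℕ) :
    ((List.range n).map f).prod = ∏ i ∈ Finset.range n, f i := by
  induction n with
  | zero => rfl
  | succ n ih =>
    rw [List.range_succ, List.map_append, List.prod_append, ih, Finset.prod_range_succ]
    simp

theorem noise_eq_noiseProd (ε δ : ℝ) (n : ℕ) {Δ : ℕ} (hΔ : 0 < Δ) :
    noise ε δ n Δ = noiseProd ε δ n Δ := by
  rw [noise, indepUnion_eq_prod, noiseProd, prod_leaders hΔ, List.prod_append, prod_flatMap,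
    List.range'_eq_map_range, List.map_map, prod_map_range, Finset.prod_Ico_eq_prod_range]
  simp only [List.prod_cons, List.prod_nil, mul_one, Function.comp_apply, mul_assoc]
  congr 3
  refine Finset.prod_congr (by congr 1) fun v _ => ?_
  have h1 : ((2 + v : ℕ) : ℤ) ≠ 1 := by omega
  have h2 : -((2 + v : ℕ) : ℤ) ≠ 1 := by omega
  have h3 : ((2 + v : ℕ) : ℤ).sign = 1 := Int.sign_eq_one_of_pos (by omega)
  simp only [zeroSumSet, h1, h2, if_false, Int.natAbs_neg, Int.natAbs_natCast, Int.sign_neg, h3,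
    one_mul, neg_mul, neg_neg]

theorem mapHom_copies {N : Type} [AddCommMonoid N] (f : Multiset ℤ →+ N) (q : PMF ℕ)
    (s : Multiset ℤ) : mapHom f (copies q s) = q.map fun k => k • f s := by
  rw [mapHom_apply, copies, PMF.map_comp]
  simp only [Function.comp_def, map_nsmul]

theorem copies_pow (q : PMF ℕ) (s : Multiset ℤ) (n : ℕ) : copies q s ^ n = copies (q ^ n) s := by
  have h (q : PMF ℕ) : copies q s = mapHom (multiplesHom _ s) q := rfl
  rw [h, h, map_pow]

theorem lam_pos : 0 < lam := by norm_num [lam]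

theorem centralParam_lt_one {ε : ℝ} {Δ : ℕ} (hε : 0 < ε) (hΔ : 0 < Δ) :
    centralParam ε Δ < 1 := by
  have : 0 < (1 - lam) * ε / Δ := by
    have : 0 < 1 - lam := by norm_num [lam]
    positivity
  rw [centralParam, Real.exp_lt_one_iff]
  linarith

theorem flood_rate_pos {ε : ℝ} {Δ v : ℕ} (hε : 0 < ε) (hΔ : 0 < Δ) (hv : 0 < v) :
    0 < 0.2 * (lam * min 1 ε / 2) * v / (Δ * (Nat.clog 2 Δ + 1)) := by
  have := lam_pos
  have : 0 < min 1 ε := lt_min one_pos hε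
  positivity

theorem floodParam_lt_one {ε : ℝ} {Δ v : ℕ} (hε : 0 < ε) (hΔ : 0 < Δ) (hv : 0 < v) :
    floodParam ε Δ v < 1 := by
  rw [floodParam, Real.exp_lt_one_iff]
  linarith [flood_rate_pos hε hΔ hv]

theorem three_lt_floodShape {δ : ℝ} {Δ : ℕ} (hδ : 0 < δ) (hΔ : 0 < Δ) : 3 < floodShape δ Δ := by
  have h1 : 1 < 2 * (Δ : ℝ) / min δ 1 := by
    rw [lt_div_iff₀ (lt_min hδ one_pos)]
    have : (1 : ℝ) ≤ Δ := by exact_mod_cast hΔ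
    linarith [min_le_right δ 1]
  have := Real.log_pos h1
  rw [floodShape]
  linarith

theorem natAbs_pos_of_mem_leaders {Δ : ℕ} {w : ℤ} (hw : w ∈ leaders Δ) : 0 < w.natAbs := by
  rw [mem_leaders] at hw
  rcases hw.2 with rfl | h
  · simp
  · rw [Int.natAbs_pos]
    rintro rfl
    simp at h

theorem noise_pow {ε δ : ℝ} {n Δ : ℕ} (hε : 0 < ε) (hδ : 0 < δ) (hn : 0 < n) (hΔ : 0 < Δ) :
    noise ε δ n Δ ^ n = noiseProd ε δ 1 Δ := by
  have hs := three_lt_floodShape hδ hΔ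
  rw [noise_eq_noiseProd _ _ _ hΔ, noiseProd, noiseProd, mul_pow, mul_pow, ← Finset.prod_pow,
    copies_pow, copies_pow, negBinomial_div_pow (p := centralParam ε Δ) zero_le_one (Real.exp_pos _).le
      (centralParam_lt_one hε hΔ) hn, div_one]
  congr 1
  refine Finset.prod_congr rfl fun w hw => ?_
  rw [copies_pow, negBinomial_div_pow (p := floodParam ε Δ w.natAbs) (by linarith) (Real.exp_pos _).le
    (floodParam_lt_one hε hΔ (natAbs_pos_of_mem_leaders hw)) hn, div_one]

/-! ### Decomposition of a message into central noise and zero-sum multisets -/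

/-- The histogram of a multiset. -/
def hist : Multiset ℤ →+ (ℤ → ℤ) where
  toFun S v := S.count v
  map_zero' := by ext; simp
  map_add' S T := by ext; simp

theorem hist_injective : Function.Injective hist := by
  intro S T h
  ext v
  exact Nat.cast_injective (R := ℤ) (congrFun h v)

/-- The message for a rounded value: zero is not sent. -/
def single (y : ℤ) : Multiset ℤ := if y = 0 then 0 else {y}

theorem hist_triple (a b c : ℤ) : hist {a, b, c} = hist {a} + hist {b} + hist {c} := by
  rw [← map_add, ← map_add]
  rfl

theorem hist_zeroSumSet_one : hist (zeroSumSet 1) = hist {1} + hist {-1} := by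
  rw [← map_add]
  rfl

theorem exists_signed_decomposition (Δ v : ℕ) (hv : 0 < v) (hvΔ : v ≤ Δ) (t : ℤ)
    (ht : t = 1 ∨ t = -1) : ∃ c : ℤ → ℤ,
      hist {t * v} = (t * v) • hist {1} + ∑ w ∈ leaders Δ, c w • hist (zeroSumSet w) ∧
      ∑ w ∈ leaders Δ, |w| * |c w| ≤ v * (Nat.clog 2 v + 1) := by
  induction v using Nat.strong_induction_on generalizing t with
  | _ v ih =>
  have sum_delta (w₀ : ℤ) (hw : w₀ ∈ leaders Δ) :
      ∑ w ∈ leaders Δ, (if w = w₀ then 1 else 0 : ℤ) • hist (zeroSumSet w) =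
        hist (zeroSumSet w₀) := by
    simp only [ite_smul, one_smul, zero_smul, Finset.sum_ite_eq', hw, if_true]
  rcases Nat.lt_or_ge v 2 with hv2 | hv2
  · obtain rfl : v = 1 := by omega
    rcases ht with rfl | rfl
    · exact ⟨0, by simp, by simp⟩
    · have h1 : (1 : ℤ) ∈ leaders Δ := by rw [mem_leaders]; simp; omega
      refine ⟨fun w => if w = 1 then 1 else 0, ?_, ?_⟩
      · rw [sum_delta 1 h1, hist_zeroSumSet_one]
        simp
      · simp [Finset.sum_ite_eq', h1, apply_ite abs, mul_ite]
  · set a := (v + 1) / 2 with ha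
    set b := v / 2 with hb
    have ht' : -t = 1 ∨ -t = -1 := by omega
    obtain ⟨c₁, e₁, k₁⟩ := ih a (by omega) (by omega) (by omega) (-t) ht'
    obtain ⟨c₂, e₂, k₂⟩ := ih b (by omega) (by omega) (by omega) (-t) ht'
    set w₀ : ℤ := t * v with hw₀
    have habs : |w₀| = v := by rcases ht with rfl | rfl <;> simp [hw₀]
    have hmem : w₀ ∈ leaders Δ := by rw [mem_leaders, habs]; omega
    have hz : zeroSumSet w₀ = {w₀, -t * a, -t * b} := by
      have h1 : w₀ ≠ 1 := by rintro h; rw [h] at habs; simp at habs; omega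
      have h2 : w₀.natAbs = v := by
        zify
        exact habs
      have h3 : w₀.sign = t := by
        rw [hw₀, Int.sign_mul, Int.sign_natCast_of_ne_zero (by omega), mul_one]
        rcases ht with rfl | rfl <;> rfl
      rw [zeroSumSet, if_neg h1, h2, h3, neg_mul, neg_mul]
    have hhist : hist {w₀} = hist (zeroSumSet w₀) - hist {-t * (a : ℤ)} - hist {-t * (b : ℤ)} := by
      rw [hz, hist_triple]
      abel
    refine ⟨fun w => (if w = w₀ then 1 else 0) - c₁ w - c₂ w, ?_, ?_⟩
    · simp only [sub_smul, Finset.sum_sub_distrib, sum_delta w₀ hmem]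
      have : (t * v) • hist {1} = -(-t * (a : ℤ)) • hist {1} - (-t * (b : ℤ)) • hist {1} := by
        rw [← sub_smul]
        congr 1
        have : (v : ℤ) = a + b := by omega
        rw [this]
        ring
      rw [hhist, this, e₁, e₂]
      rw [neg_smul]
      abel
    · have h1 : ∑ w ∈ leaders Δ, |w| * |(if w = w₀ then 1 else 0) - c₁ w - c₂ w| ≤
          ∑ w ∈ leaders Δ, (|w| * (if w = w₀ then 1 else 0) + |w| * |c₁ w| + |w| * |c₂ w|) := by
        refine Finset.sum_le_sum fun w _ => ?_
        rw [← mul_add, ← mul_add]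
        refine mul_le_mul_of_nonneg_left ?_ (abs_nonneg w)
        refine (abs_sub _ _).trans (add_le_add_left ((abs_sub _ _).trans ?_) _)
        split_ifs <;> simp
      rw [Finset.sum_add_distrib, Finset.sum_add_distrib] at h1
      have h2 : ∑ w ∈ leaders Δ, |w| * (if w = w₀ then 1 else 0) = (v : ℤ) := by
        simp [mul_ite, Finset.sum_ite_eq', hmem, habs]
      have hclog : Nat.clog 2 v = Nat.clog 2 a + 1 := by
        rw [Nat.clog_of_two_le (by omega) hv2]
        rfl
      have hclog' : Nat.clog 2 b ≤ Nat.clog 2 a := Nat.clog_mono_right 2 (by omega)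
      have h3 : (v : ℤ) = a + b := by omega
      have h4 : (b : ℤ) * (Nat.clog 2 b + 1) ≤ b * (Nat.clog 2 a + 1) := by gcongr
      rw [hclog]
      push_cast
      calc _ ≤ _ := h1
        _ ≤ (v : ℤ) + a * (Nat.clog 2 a + 1) + b * (Nat.clog 2 a + 1) := by linarith
        _ = _ := by rw [h3]; ring

theorem exists_decomposition {Δ y : ℕ} (hy : y ≤ Δ) : ∃ c : ℤ → ℤ,
    hist (single y) = (y : ℤ) • hist {1} + ∑ w ∈ leaders Δ, c w • hist (zeroSumSet w) ∧
      ∑ w ∈ leaders Δ, |w| * |c w| ≤ y * (Nat.clog 2 Δ + 1) := by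
  rcases Nat.eq_zero_or_pos y with rfl | hy0
  · exact ⟨0, by simp [single], by simp⟩
  · obtain ⟨c, h1, h2⟩ := exists_signed_decomposition Δ y hy0 hy 1 (Or.inl rfl)
    refine ⟨c, ?_, h2.trans ?_⟩
    · rw [single, if_neg (by omega)]
      simpa using h1
    · have : Nat.clog 2 y ≤ Nat.clog 2 Δ := Nat.clog_mono_right 2 hy
      gcongr

theorem exists_difference {Δ y y' : ℕ} (hΔ : 0 < Δ) (hy : y ≤ Δ) (hy' : y' ≤ Δ) :
    ∃ (a b : ℕ) (c : ℤ → ℤ),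
      hist (single y) = hist (single y') + ((a : ℤ) • hist {1} + (b : ℤ) • hist {-1} +
        ∑ w ∈ leaders Δ, c w • hist (zeroSumSet w)) ∧ a + b ≤ Δ ∧
      ∑ w ∈ leaders Δ, |w| * |c w| ≤ 2 * (Δ * (Nat.clog 2 Δ + 1)) := by
  obtain ⟨c, h1, h2⟩ := exists_decomposition hy
  obtain ⟨c', h1', h2'⟩ := exists_decomposition hy'
  have hyz : (y : ℤ) ≤ Δ := by exact_mod_cast hy
  have hyz' : (y' : ℤ) ≤ Δ := by exact_mod_cast hy'
  rcases le_total y' y with h | h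
  · refine ⟨y - y', 0, fun w => c w - c' w, ?_, by omega, ?_⟩
    · rw [h1, h1', Nat.cast_sub h]
      simp only [sub_smul, Finset.sum_sub_distrib, Nat.cast_zero, zero_smul]
      abel
    · have : ∑ w ∈ leaders Δ, |w| * |c w - c' w| ≤
          ∑ w ∈ leaders Δ, (|w| * |c w| + |w| * |c' w|) := by
        refine Finset.sum_le_sum fun w _ => ?_
        rw [← mul_add]
        exact mul_le_mul_of_nonneg_left (abs_sub _ _) (abs_nonneg w)
      rw [Finset.sum_add_distrib] at this
      nlinarith
  · have hmem : (1 : ℤ) ∈ leaders Δ := by rw [mem_leaders]; simp; omega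
    refine ⟨0, y' - y, fun w => c w - c' w - if w = 1 then (y' - y : ℤ) else 0, ?_, by omega, ?_⟩
    · rw [h1, h1', Nat.cast_sub h]
      simp only [sub_smul, Finset.sum_sub_distrib, Nat.cast_zero, zero_smul, ite_smul,
        Finset.sum_ite_eq', hmem, if_true, hist_zeroSumSet_one, smul_add]
      abel
    · have : ∑ w ∈ leaders Δ, |w| * |c w - c' w - if w = 1 then (y' - y : ℤ) else 0| ≤
          ∑ w ∈ leaders Δ, (|w| * |c w| + |w| * |c' w| +
            |w| * if w = 1 then (y' - y : ℤ) else 0) := by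
        refine Finset.sum_le_sum fun w _ => ?_
        rw [← mul_add, ← mul_add]
        refine mul_le_mul_of_nonneg_left ?_ (abs_nonneg w)
        refine (abs_sub _ _).trans (add_le_add (abs_sub _ _) ?_)
        split_ifs
        · rw [abs_of_nonneg (by omega)]
        · simp
      rw [Finset.sum_add_distrib, Finset.sum_add_distrib] at this
      have h3 : ∑ w ∈ leaders Δ, |w| * (if w = 1 then (y' - y : ℤ) else 0) = y' - y := by
        simp [mul_ite, Finset.sum_ite_eq', hmem]
      have h4 : (0 : ℤ) ≤ Nat.clog 2 Δ := by positivity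
      nlinarith

/-! ### Privacy of BaseSumDP -/

theorem mapHom_hist_copies (r p : ℝ) (s : Multiset ℤ) :
    mapHom hist (copies (negBinomial r p) s) =
      mapHom (zmultiplesHom _ (hist s)) (negBinomialInt r p) := by
  rw [mapHom_copies, mapHom_apply, negBinomialInt, PMF.map_comp]
  congr 1 with k : 1

theorem close_hist_shift {ε : ℝ} {d : ℝ≥0∞} {r p : ℝ} {k : ℤ} (s : Multiset ℤ)
    (h : Close ε d (PMF.pure k * negBinomialInt r p) (negBinomialInt r p)) :
    Close ε d (PMF.pure (k • hist s) * mapHom hist (copies (negBinomial r p) s))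
      (mapHom hist (copies (negBinomial r p) s)) := by
  have h1 : PMF.pure (k • hist s) = mapHom (zmultiplesHom _ (hist s)) (PMF.pure k) := by
    rw [mapHom_apply, PMF.pure_map]
    rfl
  rw [mapHom_hist_copies, h1, ← map_mul]
  exact h.map _

theorem exp_one_sub_floodShape_div {δ : ℝ} {Δ : ℕ} (hδ : 0 < δ) (hΔ : 0 < Δ) :
    Real.exp (1 - floodShape δ Δ / 3) = min δ 1 / (2 * Δ) := by
  have h1 : 0 < min δ 1 := lt_min hδ one_pos
  have h2 : (0 : ℝ) < Δ := by exact_mod_cast hΔ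
  rw [floodShape, show 1 - 3 * (1 + Real.log (2 * Δ / min δ 1)) / 3 =
    -Real.log (2 * Δ / min δ 1) by ring, Real.exp_neg, Real.exp_log (by positivity), inv_div]

/-- With the noise of all users, any two messages are indistinguishable. -/
theorem close_single_mul_noise {ε δ : ℝ} {Δ y y' : ℕ} (hε : 0 < ε) (hδ : 0 < δ) (hΔ : 0 < Δ)
    (hy : y ≤ Δ) (hy' : y' ≤ Δ) :
    Close ε (ENNReal.ofReal δ) (PMF.pure (single y) * noiseProd ε δ 1 Δ)
      (PMF.pure (single y') * noiseProd ε δ 1 Δ) := by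
  have hΔ' : (0 : ℝ) < Δ := by exact_mod_cast hΔ
  have hs := three_lt_floodShape hδ hΔ
  obtain ⟨a, b, c, hrep, hab, hcost⟩ := exists_difference hΔ hy hy'
  refine Close.of_map hist_injective ?_
  simp only [← mapHom_apply, map_mul, noiseProd, map_prod, div_one]
  rw [mapHom_apply hist (PMF.pure _), mapHom_apply hist (PMF.pure _), PMF.pure_map, PMF.pure_map,
    hrep, ← pure_mul_pure, ← pure_mul_pure, ← pure_mul_pure, ← prod_pure, mul_assoc (PMF.pure _)]
  refine Close.mul_left ?_ _
  rw [mul_mul_mul_comm, mul_mul_mul_comm (PMF.pure _), ← Finset.prod_mul_distrib]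
  set ρ : ℝ := (1 - lam) * ε / Δ with hρ
  have hρ0 : 0 < ρ := by
    have : 0 < 1 - lam := by norm_num [lam]
    positivity
  have hA := close_hist_shift {1} (close_shift_nat le_rfl hρ0 a)
  have hB := close_hist_shift {-1} (close_shift_nat le_rfl hρ0 b)
  set σ : ℤ → ℝ := fun w => 0.2 * (lam * min 1 ε / 2) * w.natAbs / (Δ * (Nat.clog 2 Δ + 1)) with hσ
  have hm0 : 0 < min 1 ε := lt_min one_pos hε
  have hterm (w : ℤ) : 5 * σ w * |(c w : ℝ)| =
      lam * min 1 ε / 2 / (Δ * (Nat.clog 2 Δ + 1)) * ((|w| * |c w| : ℤ) : ℝ) := by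
    simp only [hσ]
    push_cast [Nat.cast_natAbs]
    ring
  have hsum : ∑ w ∈ leaders Δ, 5 * σ w * |(c w : ℝ)| ≤ lam * min 1 ε := by
    simp only [hterm]
    rw [← Finset.mul_sum, ← Int.cast_sum]
    have : ((∑ w ∈ leaders Δ, |w| * |c w| : ℤ) : ℝ) ≤ 2 * (Δ * (Nat.clog 2 Δ + 1)) := by
      exact_mod_cast hcost
    have hl := lam_pos
    calc _ ≤ lam * min 1 ε / 2 / (Δ * (Nat.clog 2 Δ + 1)) * (2 * (Δ * (Nat.clog 2 Δ + 1))) := by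
          gcongr
      _ = _ := by field_simp
  have hσ0 : ∀ w ∈ leaders Δ, 0 < σ w := fun w hw =>
    flood_rate_pos hε hΔ (natAbs_pos_of_mem_leaders hw)
  have hle : ∀ w ∈ leaders Δ, 5 * σ w * |(c w : ℝ)| ≤ 1 := by
    intro w hw
    have h1 := Finset.single_le_sum (f := fun w => 5 * σ w * |(c w : ℝ)|)
      (fun w hw => by have := hσ0 w hw; positivity) hw
    have h2 : lam * min 1 ε ≤ 1 := by
      rw [lam]
      linarith [min_le_left 1 ε]
    exact h1.trans (hsum.trans h2)
  have hF := Close.prod (leaders Δ) fun w hw =>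
    close_hist_shift (zeroSumSet w) (close_shift (r := floodShape δ Δ) (by linarith) (hσ0 w hw)
      (c w) (hle w hw))
  refine ((hA.mul hB).mul hF).mono ?_ ?_
  · have h1 : ((a : ℝ) + b) ≤ Δ := by exact_mod_cast hab
    have h2 : ρ * a + ρ * b ≤ (1 - lam) * ε := by
      calc ρ * a + ρ * b = ρ * (a + b) := by ring
        _ ≤ ρ * Δ := by gcongr
        _ = _ := by rw [hρ]; field_simp
    have h3 : lam * min 1 ε ≤ lam * ε := by
      have := lam_pos
      gcongr
      exact min_le_right _ _
    linarith
  · rw [Finset.sum_const, nsmul_eq_mul, exp_one_sub_floodShape_div hδ hΔ, zero_add, zero_add,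
      ← ENNReal.ofReal_natCast, ← ENNReal.ofReal_mul (by positivity)]
    refine ENNReal.ofReal_le_ofReal ?_
    have h1 : ((leaders Δ).card : ℝ) ≤ 2 * Δ := by exact_mod_cast card_leaders_le Δ
    have h2 : 0 < min δ 1 := lt_min hδ one_pos
    calc _ ≤ 2 * Δ * (min δ 1 / (2 * Δ)) := by gcongr
      _ = min δ 1 := by field_simp
      _ ≤ δ := min_le_left _ _

/-! ### The structure of the two protocols -/

/-- The law of the message for the rounded input. -/
def roundMsg (x B : ℕ) : PMF (Multiset ℤ) := (randRound x B).map single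

theorem baseRandomizer_eq (ε δ : ℝ) (n U x : ℕ) :
    baseRandomizer ε δ n U x =
      roundMsg x (gridWidth ε n U) * noise ε δ n (gridSize ε n U) := by
  rw [baseRandomizer, roundMsg, mul_def, PMF.bind_map]
  congr 1 with y : 1
  simp only [Function.comp_apply]
  congr 1 with S : 1
  by_cases h : y = 0
  · simp [single, h]
  · simp only [single, h, if_false]
    rfl

theorem zeta_pos {ε : ℝ} (hε : 0 < ε) : 0 < zeta ε := by
  rw [zeta]
  positivity

theorem gridCount_pos {ε : ℝ} {n : ℕ} (hε : 0 < ε) (hn : 0 < n) :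
    0 < ⌈√((n : ℝ) / zeta ε)⌉₊ := by
  have := zeta_pos hε
  rw [Nat.ceil_pos]
  positivity

theorem gridWidth_pos {ε : ℝ} {n U : ℕ} (hε : 0 < ε) (hn : 0 < n) (hU : 0 < U) :
    0 < gridWidth ε n U := by
  have : (0 : ℝ) < ⌈√((n : ℝ) / zeta ε)⌉₊ := by exact_mod_cast gridCount_pos hε hn
  rw [gridWidth, Nat.ceil_pos]
  positivity

theorem gridSize_pos {ε : ℝ} {n U : ℕ} (hε : 0 < ε) (hn : 0 < n) (hU : 0 < U) :
    0 < gridSize ε n U := by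
  have : (0 : ℝ) < gridWidth ε n U := by exact_mod_cast gridWidth_pos hε hn hU
  rw [gridSize, Nat.ceil_pos]
  positivity

theorem mem_support_randRound {x B : ℕ} {y : ℤ} (h : y ∈ (randRound x B).support) :
    (y = ⌈(x : ℝ) / B⌉ - 1 ∧ (x : ℝ) / B < ⌈(x : ℝ) / B⌉) ∨ y = ⌈(x : ℝ) / B⌉ := by
  rw [randRound, PMF.mem_support_map_iff] at h
  obtain ⟨b, hb, rfl⟩ := h
  cases b
  · exact Or.inr (by simp)
  · refine Or.inl ⟨by simp, ?_⟩
    rw [coin, PMF.mem_support_ofFintype_iff] at hb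
    simpa using hb

theorem randRound_range {x B U : ℕ} {y : ℤ} (hx : x ≤ U)
    (h : y ∈ (randRound x B).support) : 0 ≤ y ∧ y ≤ ⌈(U : ℝ) / B⌉₊ := by
  have h1 : ⌈(x : ℝ) / B⌉ ≤ ⌈(U : ℝ) / B⌉₊ := by
    rw [Int.ceil_le]
    refine le_trans ?_ (Nat.le_ceil _)
    gcongr
  have h0 : 0 ≤ ⌈(x : ℝ) / B⌉ := Int.ceil_nonneg (by positivity)
  rcases mem_support_randRound h with ⟨rfl, h2⟩ | rfl
  · have : (0 : ℝ) < ⌈(x : ℝ) / B⌉ := lt_of_le_of_lt (by positivity) h2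
    have : 0 < ⌈(x : ℝ) / B⌉ := by exact_mod_cast this
    omega
  · exact ⟨h0, h1⟩

theorem randRound_eq_pure {x B : ℕ} {m : ℤ} (hm : (x : ℝ) / B = m) :
    randRound x B = PMF.pure m := by
  have h (y : ℤ) (hy : y ∈ (randRound x B).support) : y = m := by
    rcases mem_support_randRound hy with ⟨rfl, h2⟩ | rfl
    · simp [hm] at h2
    · simp [hm]
  have hs : (randRound x B).support = {m} :=
    Set.Subset.antisymm (fun y hy => h y hy) (by
      obtain ⟨z, hz⟩ := (randRound x B).support_nonempty
      rintro _ rfl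
      exact h z hz ▸ hz)
  ext y
  by_cases hy : y = m
  · rw [hy, PMF.pure_apply_self, PMF.apply_eq_one_iff, hs]
  · rw [PMF.pure_apply_of_ne _ _ hy, PMF.apply_eq_zero_iff, hs]
    exact hy

theorem randRound_zero (B : ℕ) : randRound 0 B = PMF.pure 0 := randRound_eq_pure (by simp)

/-- What the analyzer of BaseSumDP receives. -/
def baseShuffled (ε δ : ℝ) (n U : ℕ) (x : Fin n → ℕ) : PMF (Multiset ℤ) :=
  ∏ i, baseRandomizer ε δ n U (x i)

theorem baseShuffled_eq {ε δ : ℝ} {n U : ℕ} (hε : 0 < ε) (hδ : 0 < δ) (hn : 0 < n) (hU : 0 < U)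
    (x : Fin n → ℕ) : baseShuffled ε δ n U x =
      (∏ i, roundMsg (x i) (gridWidth ε n U)) * noiseProd ε δ 1 (gridSize ε n U) := by
  simp only [baseShuffled, baseRandomizer_eq, Finset.prod_mul_distrib, Finset.prod_const,
    Finset.card_univ, Fintype.card_fin]
  rw [noise_pow hε hδ hn (gridSize_pos hε hn hU)]

/-- The part of an input that belongs to the `j`-th sub-domain. -/
def part (j x : ℕ) : ℕ := if InSubdomain j x then x else 0

theorem part_le (j x : ℕ) : part j x ≤ 2 ^ j := by
  rw [part]
  split_ifs with h
  · exact h.2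
  · positivity

theorem part_zero (j : ℕ) : part j 0 = 0 := by
  rw [part]
  split_ifs <;> rfl

theorem inSubdomain_iff {j x : ℕ} : InSubdomain j x ↔ 0 < x ∧ Nat.clog 2 x = j := by
  rw [InSubdomain]
  rcases Nat.eq_zero_or_pos j with rfl | hj
  · simp only [if_true, pow_zero]
    constructor
    · rintro ⟨h1, h2⟩
      obtain rfl : x = 1 := by omega
      simp
    · rintro ⟨h1, h2⟩
      refine ⟨h1, ?_⟩
      have := Nat.le_pow_clog (b := 2) (by norm_num) x
      rwa [h2] at this
  · rw [if_neg hj.ne', ← Nat.clog_le_iff_le_pow (by norm_num), ← Nat.lt_clog_iff_pow_lt (by norm_num)]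
    constructor
    · rintro ⟨h1, h2⟩
      refine ⟨?_, by omega⟩
      rw [Nat.pos_iff_ne_zero]
      rintro rfl
      simp at h1
    · rintro ⟨-, h2⟩
      omega

theorem part_eq_zero_of_ne {j x : ℕ} (h : Nat.clog 2 x ≠ j) : part j x = 0 := by
  rw [part, if_neg]
  rw [inSubdomain_iff]
  tauto

/-- The tagging of messages. -/
def tagHom (j : ℕ) : Multiset ℤ →+ Multiset Msg := Multiset.mapAddMonoidHom fun y => (j, y)

theorem sumRandomizer_eq (ε δ : ℝ) (n U : ℕ) (x : Fin (U + 1)) :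
    sumRandomizer ε δ n U x = ∏ j ∈ Finset.range (Nat.log 2 U + 1),
      mapHom (tagHom j) (baseRandomizer ε δ n (2 ^ j) (part j x)) := by
  rw [sumRandomizer, indepUnion_eq_prod, prod_map_range]
  rfl

theorem shuffled_sumRandomizer_eq (ε δ : ℝ) (n U : ℕ) (D : Fin n → Fin (U + 1)) :
    shuffled (sumRandomizer ε δ n U) D = ∏ j ∈ Finset.range (Nat.log 2 U + 1),
      mapHom (tagHom j) (baseShuffled ε δ n (2 ^ j) fun i => part j (D i)) := by
  rw [shuffled_eq_prod]
  simp only [sumRandomizer_eq, baseShuffled, map_prod]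
  exact Finset.prod_comm

/-! ### Privacy -/

theorem close_baseShuffled {ε δ : ℝ} {n U : ℕ} (hε : 0 < ε) (hδ : 0 < δ) (hn : 0 < n) (hU : 0 < U)
    {x x' : Fin n → ℕ} (i : Fin n) (hx : x i ≤ U) (hx' : x' i ≤ U) (h : ∀ k, k ≠ i → x k = x' k) :
    Close ε (ENNReal.ofReal δ) (baseShuffled ε δ n U x) (baseShuffled ε δ n U x') := by
  classical
  rw [baseShuffled_eq hε hδ hn hU, baseShuffled_eq hε hδ hn hU,
    ← Finset.prod_erase_mul _ _ (Finset.mem_univ i), ← Finset.prod_erase_mul _ _ (Finset.mem_univ i),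
    mul_assoc, mul_assoc, Finset.prod_congr rfl fun k hk => by rw [h k (Finset.ne_of_mem_erase hk)]]
  refine Close.mul_left ?_ _
  rw [roundMsg, roundMsg, ← PMF.bind_pure_comp, ← PMF.bind_pure_comp, bind_mul, bind_mul]
  refine Close.bind _ _ fun y hy y' hy' => ?_
  obtain ⟨h1, h2⟩ := randRound_range hx hy
  obtain ⟨h1', h2'⟩ := randRound_range hx' hy'
  lift y to ℕ using h1
  lift y' to ℕ using h1'
  exact close_single_mul_noise hε hδ (gridSize_pos hε hn hU) (by exact_mod_cast h2)
    (by exact_mod_cast h2')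

theorem close_shuffled {ε δ : ℝ} {n U : ℕ} (hε : 0 < ε) (hδ : 0 < δ) (hn : 0 < n)
    {D D' : Fin n → Fin (U + 1)} (i : Fin n) (h : ∀ k, k ≠ i → D k = D' k) (J : Finset ℕ)
    (hJ : ∀ j ∉ J, part j (D i) = part j (D' i)) :
    Close (J.card * ε) (J.card * ENNReal.ofReal δ) (shuffled (sumRandomizer ε δ n U) D)
      (shuffled (sumRandomizer ε δ n U) D') := by
  rw [shuffled_sumRandomizer_eq, shuffled_sumRandomizer_eq]
  set R := Finset.range (Nat.log 2 U + 1)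
  have hc (j : ℕ) : Close (if j ∈ J then ε else 0) (if j ∈ J then ENNReal.ofReal δ else 0)
      (mapHom (tagHom j) (baseShuffled ε δ n (2 ^ j) fun i => part j (D i)))
      (mapHom (tagHom j) (baseShuffled ε δ n (2 ^ j) fun i => part j (D' i))) := by
    split_ifs with hj
    · exact (close_baseShuffled hε hδ hn (by positivity) i (part_le _ _) (part_le _ _)
        fun k hk => by rw [h k hk]).map _
    · have : (fun k => part j (D k)) = fun k => part j (D' k) := by
        funext k
        by_cases hk : k = i
        · rw [hk, hJ j hj]
        · rw [h k hk]
      rw [this]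
      exact Close.refl _
  refine (Close.prod R fun j _ => hc j).mono ?_ ?_
  · rw [← Finset.sum_filter, Finset.sum_const, nsmul_eq_mul]
    gcongr
    exact fun j hj => (Finset.mem_filter.1 hj).2
  · rw [← Finset.sum_filter, Finset.sum_const, nsmul_eq_mul]
    gcongr
    exact fun j hj => (Finset.mem_filter.1 hj).2

theorem isDP_addRemove {ε δ : ℝ} {n U : ℕ} (hε : 0 < ε) (hδ : 0 < δ) (hn : 0 < n) :
    IsDP (AddRemove (n := n) (U := U)) ε δ (shuffled (sumRandomizer ε δ n U)) := by
  rintro D D' ⟨i, h, h0⟩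
  obtain ⟨j₀, hj₀⟩ : ∃ j₀, ∀ j, j ≠ j₀ → part j (D i) = part j (D' i) := by
    rcases h0 with h0 | h0
    · refine ⟨Nat.clog 2 (D' i), fun j hj => ?_⟩
      rw [h0, Fin.val_zero, part_zero, part_eq_zero_of_ne hj.symm]
    · refine ⟨Nat.clog 2 (D i), fun j hj => ?_⟩
      rw [h0, Fin.val_zero, part_zero, part_eq_zero_of_ne hj.symm]
  refine Close.indist ?_
  simpa using close_shuffled hε hδ hn i h {j₀} fun j hj => hj₀ j (by simpa using hj)

theorem isDP_replace {ε δ : ℝ} {n U : ℕ} (hε : 0 < ε) (hδ : 0 < δ) (hn : 0 < n) :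
    IsDP (Replace (n := n) (U := U)) (2 * ε) (2 * δ) (shuffled (sumRandomizer ε δ n U)) := by
  rintro D D' ⟨i, h⟩
  refine Close.indist ?_
  refine (close_shuffled hε hδ hn i h {Nat.clog 2 (D i), Nat.clog 2 (D' i)} fun j hj => ?_).mono
    ?_ ?_
  · simp only [Finset.mem_insert, Finset.mem_singleton, not_or] at hj
    rw [part_eq_zero_of_ne (Ne.symm hj.1), part_eq_zero_of_ne (Ne.symm hj.2)]
  · gcongr
    exact_mod_cast Finset.card_le_two
  · rw [ENNReal.ofReal_mul (by norm_num), ENNReal.ofReal_ofNat]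
    gcongr
    exact_mod_cast Finset.card_le_two

/-! ### The rounding grid -/

theorem three_lt_gridCount {ε : ℝ} {n : ℕ} (hε : 0 < ε) (hn : 0 < n) :
    3 < ⌈√((n : ℝ) / zeta ε)⌉₊ := by
  rw [Nat.lt_ceil, Nat.cast_ofNat]
  refine Real.lt_sqrt_of_sq_lt ?_
  have h1 : zeta ε ≤ 0.1 := min_le_left _ _
  have h2 : (1 : ℝ) ≤ n := by exact_mod_cast hn
  rw [lt_div_iff₀ (zeta_pos hε)]
  linarith

theorem ceil_div_bounds {V G : ℕ} (hG : 0 < G) :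
    V ≤ ⌈(V : ℝ) / G⌉₊ * G ∧ ⌈(V : ℝ) / G⌉₊ * G < V + G := by
  have hG' : (0 : ℝ) < G := by exact_mod_cast hG
  have h1 := Nat.le_ceil ((V : ℝ) / G)
  have h2 := Nat.ceil_lt_add_one (a := (V : ℝ) / G) (by positivity)
  rw [div_le_iff₀ hG'] at h1
  constructor
  · exact_mod_cast h1
  · have : (⌈(V : ℝ) / G⌉₊ : ℝ) * G < V + G := by
      calc _ < ((V : ℝ) / G + 1) * G := by gcongr
        _ = _ := by field_simp
    exact_mod_cast this

theorem gridSize_le_gridCount {ε : ℝ} {n U : ℕ} (hε : 0 < ε) (hn : 0 < n) (hU : 0 < U) :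
    gridSize ε n U ≤ ⌈√((n : ℝ) / zeta ε)⌉₊ := by
  have h1 := (ceil_div_bounds (V := U) (gridCount_pos hε hn)).1
  have hB := gridWidth_pos hε hn hU
  have h2 := (ceil_div_bounds (V := U) hB).2
  change gridSize ε n U * gridWidth ε n U < U + gridWidth ε n U at h2
  change U ≤ gridWidth ε n U * _ at h1
  by_contra! h
  nlinarith

/-- Rounding up the grid enlarges a dyadic domain by at most 17 percent. -/
theorem gridWidth_mul_gridSize_le {ε : ℝ} {n : ℕ} (hε : 0 < ε) (hn : 0 < n) (j : ℕ) :
    (gridWidth ε n (2 ^ j) : ℝ) * gridSize ε n (2 ^ j) ≤ 1.17 * 2 ^ j := by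
  have hV : 0 < 2 ^ j := by positivity
  have hG := three_lt_gridCount hε hn
  have hΔG := gridSize_le_gridCount hε hn hV
  have hB := gridWidth_pos hε hn hV
  have h1 := ceil_div_bounds (V := 2 ^ j) (gridCount_pos hε hn)
  have h2 := (ceil_div_bounds (V := 2 ^ j) hB).2
  change gridSize ε n (2 ^ j) * gridWidth ε n (2 ^ j) < _ at h2
  change _ ≤ gridWidth ε n (2 ^ j) * _ ∧ gridWidth ε n (2 ^ j) * _ < _ at h1
  generalize gridWidth ε n (2 ^ j) = B at *
  generalize gridSize ε n (2 ^ j) = Δ at *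
  generalize ⌈√((n : ℝ) / zeta ε)⌉₊ = G at *
  obtain ⟨h0, h1⟩ := h1
  suffices h : 100 * (B * Δ) ≤ 117 * 2 ^ j by
    have : (100 : ℝ) * (B * Δ) ≤ 117 * 2 ^ j := by exact_mod_cast h
    linarith
  rw [mul_comm Δ] at h2
  have h3 : B * Δ ≤ B * G := Nat.mul_le_mul_left _ hΔG
  rcases (by omega : B = 1 ∨ 2 ≤ B) with rfl | hB2
  · omega
  rcases (by omega : G = 4 ∨ G = 5 ∨ 6 ≤ G) with rfl | rfl | hG6
  · rcases j with _ | _ | j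
    · omega
    · omega
    · rw [pow_add] at *
      omega
  · rcases (by omega : j = 0 ∨ j = 1 ∨ j = 2 ∨ j = 3 ∨ j = 4 ∨ 5 ≤ j) with
      rfl | rfl | rfl | rfl | rfl | hj
    · omega
    · omega
    · omega
    · obtain rfl : B = 2 := by omega
      omega
    · obtain rfl : B = 4 := by omega
      omega
    · have : 2 ^ 5 ≤ 2 ^ j := Nat.pow_le_pow_right (by norm_num) hj
      omega
  · obtain ⟨b, rfl⟩ : ∃ b, B = b + 1 := ⟨B - 1, by omega⟩
    have : b * 6 ≤ b * G := Nat.mul_le_mul_left _ hG6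
    rw [add_mul, one_mul] at h1
    omega

theorem gridWidth_mul_sqrt_le {ε : ℝ} {n U : ℕ} (hε : 0 < ε) (hn : 0 < n)
    (hB : gridWidth ε n U ≠ 1) : (gridWidth ε n U : ℝ) * √n ≤ U := by
  rcases Nat.eq_zero_or_pos U with rfl | hU
  · simp [gridWidth]
  have hn' : (0 : ℝ) < n := by exact_mod_cast hn
  have h1 := (ceil_div_bounds (V := U) (gridCount_pos hε hn)).2
  change gridWidth ε n U * _ < _ at h1
  have hB2 : 2 ≤ gridWidth ε n U := by
    have := gridWidth_pos hε hn hU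
    omega
  have hG : 2 * √(n : ℝ) ≤ ⌈√((n : ℝ) / zeta ε)⌉₊ := by
    refine le_trans ?_ (Nat.le_ceil _)
    refine Real.le_sqrt_of_sq_le ?_
    rw [mul_pow, Real.sq_sqrt hn'.le, le_div_iff₀ (zeta_pos hε)]
    have h1 : zeta ε ≤ 0.1 := min_le_left _ _
    nlinarith
  generalize gridWidth ε n U = B at *
  generalize ⌈√((n : ℝ) / zeta ε)⌉₊ = G at *
  have h2 : B * G ≤ 2 * U := by nlinarith
  have h2' : (B : ℝ) * G ≤ 2 * U := by exact_mod_cast h2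
  have h3 : (B : ℝ) * (2 * √n) ≤ B * G := by gcongr
  linarith

/-! ### The law of the sum of the messages -/

/-- The sum of a multiset of integers, as a homomorphism. -/
def sumHom : Multiset ℤ →+ ℤ := Multiset.sumAddMonoidHom

theorem sum_zeroSumSet (w : ℤ) : (zeroSumSet w).sum = 0 := by
  rw [zeroSumSet]
  split_ifs with h
  · rfl
  · have h1 : w.sign * (w.natAbs : ℤ) = w := Int.sign_mul_natAbs w
    have h2 : (w.natAbs : ℤ) = ((w.natAbs + 1) / 2 : ℕ) + (w.natAbs / 2 : ℕ) := by omega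
    simp only [Multiset.insert_eq_cons, Multiset.sum_cons, Multiset.sum_singleton]
    nth_rw 1 [← h1]
    rw [h2]
    ring

theorem mapHom_sumHom_roundMsg (x B : ℕ) : mapHom sumHom (roundMsg x B) = randRound x B := by
  rw [mapHom_apply, roundMsg, PMF.map_comp]
  have : (sumHom ∘ single) = id := by
    funext y
    by_cases h : y = 0 <;> simp [single, h, sumHom]
  rw [this, PMF.map_id]

/-- The central noise of all users: the difference of two geometric variables. -/
def geometric (ε : ℝ) (Δ : ℕ) : PMF ℕ := negBinomial 1 (centralParam ε Δ)

theorem mapHom_sumHom_baseShuffled {ε δ : ℝ} {n U : ℕ} (hε : 0 < ε) (hδ : 0 < δ) (hn : 0 < n)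
    (hU : 0 < U) (x : Fin n → ℕ) : mapHom sumHom (baseShuffled ε δ n U x) =
      (∏ i, randRound (x i) (gridWidth ε n U)) *
        (PMF.map (fun k : ℕ => (k : ℤ)) (geometric ε (gridSize ε n U)) *
          PMF.map (fun k : ℕ => -(k : ℤ)) (geometric ε (gridSize ε n U))) := by
  rw [baseShuffled_eq hε hδ hn hU, map_mul, map_prod]
  simp only [mapHom_sumHom_roundMsg, noiseProd, map_mul, map_prod, mapHom_copies, div_one]
  congr 1
  rw [Finset.prod_eq_one, mul_one]
  · simp only [geometric, sumHom, Multiset.coe_sumAddMonoidHom, Multiset.sum_singleton,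
      nsmul_eq_mul, mul_one, mul_neg]
  · intro w _
    exact map_eq_one _ fun k => by simp [sumHom, sum_zeroSumSet]

theorem toOuterMeasure_mul_le {M : Type} [AddCommMonoid M] (p q : PMF M) {A A₁ A₂ : Set M}
    (h : ∀ a b, a + b ∈ A → a ∈ A₁ ∨ b ∈ A₂) :
    (p * q).toOuterMeasure A ≤ p.toOuterMeasure A₁ + q.toOuterMeasure A₂ := by
  rw [toOuterMeasure_eq_ev, toOuterMeasure_eq_ev, toOuterMeasure_eq_ev, ev_mul,
    ← ev_const p (ev q _), ← ev_add]
  refine ev_mono _ fun a => ?_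
  rw [← ev_const q (A₁.indicator _ a), ← ev_add]
  refine ev_mono _ fun b => ?_
  by_cases hA : a + b ∈ A
  · rcases h a b hA with h1 | h1 <;> simp [hA, h1]
  · simp [hA]

theorem geometric_tail {ε : ℝ} {Δ : ℕ} (hε : 0 < ε) (hΔ : 0 < Δ) (s : ℝ) :
    (geometric ε Δ).toOuterMeasure {k | s < k} ≤
      ENNReal.ofReal (Real.exp (-((1 - lam) * ε / Δ * s))) := by
  set p := centralParam ε Δ with hp
  have hp0 : 0 ≤ p := (Real.exp_pos _).le
  have hp1 : p < 1 := centralParam_lt_one hε hΔ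
  have happ (k : ℕ) : geometric ε Δ k = ENNReal.ofReal ((1 - p) * p ^ k) := by
    rw [geometric, negBinomial_apply zero_le_one hp0 hp1, negBinomialReal_one]
  set m := ⌈s⌉₊ with hm
  have h1 : (geometric ε Δ).toOuterMeasure {k | s < k} ≤
      (geometric ε Δ).toOuterMeasure {k | m ≤ k} :=
    MeasureTheory.measure_mono fun k hk => Nat.ceil_le.2 (le_of_lt hk)
  have h2 : (geometric ε Δ).toOuterMeasure {k | m ≤ k} = ENNReal.ofReal (p ^ m) := by
    rw [PMF.toOuterMeasure_apply, ← (add_right_injective m).tsum_eq]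
    · have (k : ℕ) : Set.indicator {k | m ≤ k} (geometric ε Δ) (m + k) =
          ENNReal.ofReal (p ^ m) * geometric ε Δ k := by
        rw [Set.indicator_of_mem (by simp), happ, happ, ← ENNReal.ofReal_mul (by positivity)]
        congr 1
        ring
      simp only [this]
      rw [ENNReal.tsum_mul_left, PMF.tsum_coe, mul_one]
    · intro k hk
      have : m ≤ k := by
        by_contra hcon
        exact hk (Set.indicator_of_notMem (by simpa using hcon) _)
      exact ⟨k - m, by simp only; omega⟩
  refine h1.trans (h2.le.trans (ENNReal.ofReal_le_ofReal ?_))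
  rw [hp, centralParam, ← Real.exp_nat_mul]
  refine Real.exp_le_exp.2 ?_
  have h3 : s ≤ m := Nat.le_ceil s
  have h4 : 0 ≤ (1 - lam) * ε / Δ := by
    have : 0 < 1 - lam := by norm_num [lam]
    positivity
  nlinarith

/-! ### Concentration of the rounding errors -/

theorem ev_randRound (x B : ℕ) (f : ℤ → ℝ≥0∞) : ev (randRound x B) f =
    ENNReal.ofReal ((⌈(x : ℝ) / B⌉ : ℝ) - (x : ℝ) / B) * f (⌈(x : ℝ) / B⌉ - 1) +
      ENNReal.ofReal (1 - ((⌈(x : ℝ) / B⌉ : ℝ) - (x : ℝ) / B)) * f ⌈(x : ℝ) / B⌉ := by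
  rw [randRound, ev_map, ev, tsum_fintype, Fintype.sum_bool]
  simp [coin, PMF.ofFintype_apply]

theorem exp_mix_le {q t : ℝ} (hq0 : 0 ≤ q) (hq1 : q ≤ 1) (ht : |t| ≤ 1) :
    q * Real.exp (t * (q - 1)) + (1 - q) * Real.exp (t * q) ≤ Real.exp (t ^ 2) := by
  have key (z : ℝ) (hz : |z| ≤ 1) : Real.exp (t * z) ≤ 1 + t * z + (t * z) ^ 2 := by
    have h := Real.abs_exp_sub_one_sub_id_le (x := t * z)
      (by rw [abs_mul]; exact mul_le_one₀ ht (abs_nonneg _) hz)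
    linarith [(abs_le.1 h).2]
  have h1 := key (q - 1) (by rw [abs_le]; constructor <;> linarith)
  have h2 := key q (by rw [abs_le]; constructor <;> linarith)
  have h3 := Real.add_one_le_exp (t ^ 2)
  calc _ ≤ q * (1 + t * (q - 1) + (t * (q - 1)) ^ 2) + (1 - q) * (1 + t * q + (t * q) ^ 2) := by
        have : 0 ≤ 1 - q := by linarith
        gcongr
    _ = 1 + t ^ 2 * (q * (1 - q)) := by ring
    _ ≤ t ^ 2 + 1 := by
        have : q * (1 - q) ≤ 1 := by nlinarith
        nlinarith [sq_nonneg t]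
    _ ≤ _ := h3

theorem ev_randRound_exp_le (x B : ℕ) {t : ℝ} (ht : |t| ≤ 1) :
    ev (randRound x B) (fun z => ENNReal.ofReal (Real.exp (t * z))) ≤
      ENNReal.ofReal (Real.exp (t * (x / B) + t ^ 2)) := by
  set c := ⌈(x : ℝ) / B⌉ with hc
  have h1 := Int.le_ceil ((x : ℝ) / B)
  have h2 := Int.ceil_lt_add_one ((x : ℝ) / B)
  rw [← hc] at h1 h2
  rw [ev_randRound, ← hc, ← ENNReal.ofReal_mul (by linarith), ← ENNReal.ofReal_mul (by linarith),
    ← ENNReal.ofReal_add (mul_nonneg (by linarith) (Real.exp_pos _).le)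
      (mul_nonneg (by linarith) (Real.exp_pos _).le)]
  refine ENNReal.ofReal_le_ofReal ?_
  set y := (x : ℝ) / B
  have h3 := exp_mix_le (q := c - y) (by linarith) (by linarith) ht
  have e1 : Real.exp (t * ((c - 1 : ℤ) : ℝ)) = Real.exp (t * y) * Real.exp (t * (c - y - 1)) := by
    rw [← Real.exp_add]
    push_cast
    ring_nf
  have e2 : Real.exp (t * c) = Real.exp (t * y) * Real.exp (t * (c - y)) := by
    rw [← Real.exp_add]
    ring_nf
  rw [e1, e2, Real.exp_add]
  calc _ = Real.exp (t * y) * ((c - y) * Real.exp (t * (c - y - 1)) +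
        (1 - (c - y)) * Real.exp (t * (c - y))) := by ring
    _ ≤ _ := by gcongr

theorem prod_randRound_tail {n : ℕ} (x : Fin n → ℕ) (B : ℕ) {t : ℝ} (ht : |t| ≤ 1)
    (htn : n * t ^ 2 = 1) (s : ℝ) :
    (∏ i, randRound (x i) B).toOuterMeasure {z | s < t * (z - ∑ i, (x i : ℝ) / B)} ≤
      ENNReal.ofReal (Real.exp (1 - s)) := by
  set m : ℝ := ∑ i, (x i : ℝ) / B with hm
  have hev : ev (∏ i, randRound (x i) B) (fun z => ENNReal.ofReal (Real.exp (t * z))) ≤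
      ENNReal.ofReal (Real.exp (t * m + 1)) := by
    rw [ev_prod_of_map_add _ _ (by simp) (fun a b => by
      rw [← ENNReal.ofReal_mul (Real.exp_pos _).le, ← Real.exp_add]; push_cast; ring_nf)]
    refine (Finset.prod_le_prod' fun i _ => ev_randRound_exp_le (x i) B ht).trans ?_
    rw [← ENNReal.ofReal_prod_of_nonneg fun i _ => (Real.exp_pos _).le, ← Real.exp_sum,
      Finset.sum_add_distrib, ← Finset.mul_sum, Finset.sum_const, Finset.card_univ,
      Fintype.card_fin, nsmul_eq_mul, htn]
  refine (toOuterMeasure_le_of_le _ (c := ENNReal.ofReal (Real.exp (-(t * m + s))))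
    (f := fun z : ℤ => ENNReal.ofReal (Real.exp (t * z))) fun z hz => ?_).trans ?_
  · rw [← ENNReal.ofReal_mul (Real.exp_pos _).le, ← Real.exp_add, ENNReal.one_le_ofReal]
    refine Real.one_le_exp ?_
    have : s < t * (z - m) := hz
    linarith
  · refine (mul_le_mul_right hev _).trans_eq ?_
    rw [← ENNReal.ofReal_mul (Real.exp_pos _).le, ← Real.exp_add]
    ring_nf

theorem two_mul_exp_neg_le {Λ s : ℝ} (hs : Λ + Real.log 2 ≤ s) :
    2 * Real.exp (-s) ≤ Real.exp (-Λ) := by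
  calc 2 * Real.exp (-s) = Real.exp (Real.log 2 - s) := by
        rw [sub_eq_add_neg, Real.exp_add, Real.exp_log (by norm_num)]
    _ ≤ _ := Real.exp_le_exp.2 (by linarith)

theorem rounding_tail {ε : ℝ} {n U : ℕ} (hε : 0 < ε) (hn : 0 < n) (hU : 0 < U)
    (x : Fin n → ℕ) {Λ : ℝ} (hΛ : Real.log 2 ≤ Λ) :
    (∏ i, randRound (x i) (gridWidth ε n U)).toOuterMeasure
      {z | 4 * Λ * U < |(z : ℝ) * gridWidth ε n U - ∑ i, (x i : ℝ)|} ≤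
        ENNReal.ofReal (Real.exp (-Λ)) := by
  have hlog2 := Real.log_two_gt_d9
  have hlog2' := Real.log_two_lt_d9
  have hΛ0 : 0 < Λ := by linarith
  by_cases hB : gridWidth ε n U = 1
  · have h1 : ∏ i, randRound (x i) (gridWidth ε n U) = PMF.pure (∑ i, (x i : ℤ)) := by
      rw [← prod_pure]
      refine Finset.prod_congr rfl fun i _ => randRound_eq_pure ?_
      simp [hB]
    rw [h1, PMF.toOuterMeasure_pure_apply, if_neg]
    · simp
    · simp only [hB, Set.mem_ofPred_eq, not_lt]
      push_cast
      simp only [mul_one, sub_self, abs_zero]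
      positivity
  · have hn' : (0 : ℝ) < n := by exact_mod_cast hn
    have hn1 : (1 : ℝ) ≤ n := by exact_mod_cast hn
    have hsq : (√(n : ℝ)) ^ 2 = n := Real.sq_sqrt hn'.le
    have hs1 : 1 ≤ √(n : ℝ) := Real.one_le_sqrt.2 hn1
    have hBn := gridWidth_mul_sqrt_le hε hn hB
    have hBpos := gridWidth_pos hε hn hU
    generalize gridWidth ε n U = B at *
    set t : ℝ := (√(n : ℝ))⁻¹ with ht
    have ht0 : 0 < t := by positivity
    have ht1 : |t| ≤ 1 := by rw [abs_of_pos ht0]; exact inv_le_one_of_one_le₀ hs1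
    have htn : n * t ^ 2 = 1 := by rw [ht, inv_pow, hsq]; field_simp
    have hcov : {z : ℤ | 4 * Λ * U < |(z : ℝ) * B - ∑ i, (x i : ℝ)|} ⊆
        {z : ℤ | 4 * Λ < t * (z - ∑ i, (x i : ℝ) / B)} ∪
          {z : ℤ | 4 * Λ < (-t) * (z - ∑ i, (x i : ℝ) / B)} := by
      intro z hz
      have hz' : 4 * Λ * U < |(z : ℝ) * B - ∑ i, (x i : ℝ)| := hz
      have hBp : (0 : ℝ) < B := by exact_mod_cast hBpos
      have he : (z : ℝ) * B - ∑ i, (x i : ℝ) = B * (z - ∑ i, (x i : ℝ) / B) := by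
        rw [← Finset.sum_div]
        field_simp
      rw [he, abs_mul, abs_of_pos hBp] at hz'
      have h1 : 4 * Λ * (B * √n) < B * |(z : ℝ) - ∑ i, (x i : ℝ) / B| :=
        lt_of_le_of_lt (by gcongr) hz'
      have h2 : 4 * Λ < t * |(z : ℝ) - ∑ i, (x i : ℝ) / B| := by
        rw [ht, inv_mul_eq_div, lt_div_iff₀ (by linarith)]
        refine lt_of_mul_lt_mul_left (a := (B : ℝ)) ?_ hBp.le
        linarith
      rcases abs_cases ((z : ℝ) - ∑ i, (x i : ℝ) / B) with ⟨h3, -⟩ | ⟨h3, -⟩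
      · left
        rw [h3] at h2
        exact h2
      · right
        rw [h3] at h2
        change 4 * Λ < -t * _
        linarith
    refine (MeasureTheory.measure_mono hcov).trans ((MeasureTheory.measure_union_le _ _).trans ?_)
    refine (add_le_add (prod_randRound_tail x B ht1 htn _)
      (prod_randRound_tail x B (by rwa [abs_neg]) (by rwa [neg_sq]) _)).trans ?_
    rw [← ENNReal.ofReal_add (Real.exp_pos _).le (Real.exp_pos _).le, ← two_mul]
    refine ENNReal.ofReal_le_ofReal ?_
    have := two_mul_exp_neg_le (Λ := Λ) (s := 4 * Λ - 1) (by linarith)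
    rwa [neg_sub] at this

/-! ### The error of BaseSumDP -/

theorem central_noise_tail {ε : ℝ} {Δ : ℕ} (hε : 0 < ε) (hΔ : 0 < Δ) (s : ℝ) :
    (PMF.map (fun k : ℕ => (k : ℤ)) (geometric ε Δ) *
      PMF.map (fun k : ℕ => -(k : ℤ)) (geometric ε Δ)).toOuterMeasure {z | s < |(z : ℝ)|} ≤
      ENNReal.ofReal (2 * Real.exp (-((1 - lam) * ε / Δ * s))) := by
  refine (toOuterMeasure_mul_le _ _ (A₁ := {a : ℤ | s < a ∨ a < 0})
    (A₂ := {b : ℤ | s < -(b : ℝ) ∨ 0 < b})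
    fun a b hab => ?_).trans ?_
  · change (s < a ∨ a < 0) ∨ (s < -(b : ℝ) ∨ 0 < b)
    by_contra! hcon
    obtain ⟨⟨h1, h2⟩, h3, h4⟩ := hcon
    have h2' : (0 : ℝ) ≤ a := by exact_mod_cast h2
    have h4' : (b : ℝ) ≤ 0 := by exact_mod_cast h4
    have hab' : s < |((a + b : ℤ) : ℝ)| := hab
    push_cast at hab'
    rcases lt_abs.1 hab' with h | h <;> linarith
  · rw [two_mul, ENNReal.ofReal_add (Real.exp_pos _).le (Real.exp_pos _).le,
      PMF.toOuterMeasure_map_apply, PMF.toOuterMeasure_map_apply]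
    refine add_le_add (le_trans (MeasureTheory.measure_mono fun k hk => ?_)
      (geometric_tail hε hΔ s)) (le_trans (MeasureTheory.measure_mono fun k hk => ?_)
      (geometric_tail hε hΔ s))
    · rcases (show s < ((k : ℤ) : ℝ) ∨ (k : ℤ) < 0 from hk) with h | h
      · simpa using h
      · omega
    · rcases (show s < -((-(k : ℤ) : ℤ) : ℝ) ∨ 0 < -(k : ℤ) from hk) with h | h
      · simpa using h
      · omega

theorem central_noise_upper_tail {ε : ℝ} {Δ : ℕ} (hε : 0 < ε) (hΔ : 0 < Δ) (s : ℝ) :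
    (PMF.map (fun k : ℕ => (k : ℤ)) (geometric ε Δ) *
      PMF.map (fun k : ℕ => -(k : ℤ)) (geometric ε Δ)).toOuterMeasure {z | s < (z : ℝ)} ≤
      ENNReal.ofReal (Real.exp (-((1 - lam) * ε / Δ * s))) := by
  refine (toOuterMeasure_mul_le _ _ (A₁ := {a : ℤ | s < a}) (A₂ := {b : ℤ | 0 < b})
    fun a b hab => ?_).trans ?_
  · change s < a ∨ 0 < b
    by_contra! hcon
    have h4' : (b : ℝ) ≤ 0 := by exact_mod_cast hcon.2
    have hab' : s < ((a + b : ℤ) : ℝ) := hab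
    push_cast at hab'
    linarith
  · rw [PMF.toOuterMeasure_map_apply, PMF.toOuterMeasure_map_apply]
    have h0 : ((fun k : ℕ => -(k : ℤ)) ⁻¹' {b : ℤ | 0 < b}) = ∅ := by
      ext k
      simp
    rw [h0, MeasureTheory.measure_empty, add_zero]
    exact (MeasureTheory.measure_mono fun k hk => by simpa using hk).trans (geometric_tail hε hΔ s)

theorem base_error {ε δ : ℝ} {n : ℕ} (hε : 0 < ε) (hδ : 0 < δ) (hn : 0 < n) (j : ℕ)
    (x : Fin n → ℕ) {Λ : ℝ} (hΛ : Real.log 2 ≤ Λ) :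
    (mapHom sumHom (baseShuffled ε δ n (2 ^ j) x)).toOuterMeasure
      {z | (3 + 4 * ε) * (2 ^ j * (Λ / ε)) <
        |(z : ℝ) * gridWidth ε n (2 ^ j) - ∑ i, (x i : ℝ)|} ≤
      ENNReal.ofReal (2 * Real.exp (-Λ)) := by
  have hV : 0 < 2 ^ j := by positivity
  have hΔ := gridSize_pos hε hn hV
  have hB := gridWidth_pos hε hn hV
  have hBΔ := gridWidth_mul_gridSize_le hε hn j
  have hlog2 := Real.log_two_gt_d9
  have hΛ0 : 0 < Λ := by linarith
  rw [mapHom_sumHom_baseShuffled hε hδ hn hV]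
  have hr := rounding_tail (U := 2 ^ j) hε hn hV x hΛ
  generalize gridWidth ε n (2 ^ j) = B at *
  generalize gridSize ε n (2 ^ j) = Δ at *
  have hΔ' : (0 : ℝ) < Δ := by exact_mod_cast hΔ
  have hB' : (0 : ℝ) < B := by exact_mod_cast hB
  set s : ℝ := 2 * Λ * Δ / (0.9 * ε) with hs
  have hc := central_noise_tail hε hΔ s
  refine (toOuterMeasure_mul_le _ _ (A₁ := {z : ℤ | 4 * Λ * (2 ^ j : ℕ) <
    |(z : ℝ) * B - ∑ i, (x i : ℝ)|}) (A₂ := {z : ℤ | s < |(z : ℝ)|}) fun a b hab => ?_).trans ?_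
  · change 4 * Λ * (2 ^ j : ℕ) < |(a : ℝ) * B - ∑ i, (x i : ℝ)| ∨ s < |(b : ℝ)|
    by_contra! hcon
    obtain ⟨h1, h2⟩ := hcon
    have hab' : (3 + 4 * ε) * (2 ^ j * (Λ / ε)) <
        |((a + b : ℤ) : ℝ) * B - ∑ i, (x i : ℝ)| := hab
    have h3 : |((a + b : ℤ) : ℝ) * B - ∑ i, (x i : ℝ)| ≤
        |(a : ℝ) * B - ∑ i, (x i : ℝ)| + B * |(b : ℝ)| := by
      rw [← abs_of_pos hB', ← abs_mul, abs_of_pos hB']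
      refine le_trans (le_of_eq ?_) (abs_add_le _ _)
      push_cast
      ring_nf
    have h4 : (B : ℝ) * |(b : ℝ)| ≤ 3 * (2 ^ j * (Λ / ε)) := by
      calc (B : ℝ) * |(b : ℝ)| ≤ B * s := by gcongr
        _ = B * Δ * (2 * (Λ / ε) / 0.9) := by rw [hs]; field_simp
        _ ≤ 1.17 * 2 ^ j * (2 * (Λ / ε) / 0.9) := by gcongr
        _ = 2.6 * (2 ^ j * (Λ / ε)) := by ring
        _ ≤ _ := by gcongr; norm_num
    have h5 : 4 * Λ * ((2 ^ j : ℕ) : ℝ) = 4 * ε * (2 ^ j * (Λ / ε)) := by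
      push_cast
      field_simp
    linarith
  · rw [two_mul, ENNReal.ofReal_add (Real.exp_pos _).le (Real.exp_pos _).le]
    refine add_le_add hr (hc.trans (ENNReal.ofReal_le_ofReal (two_mul_exp_neg_le ?_)))
    have : (1 - lam) * ε / Δ * s = 2 * Λ := by
      rw [hs, lam]
      field_simp
      norm_num
    rw [this]
    linarith

theorem base_zero_tail {ε δ : ℝ} {n : ℕ} (hε : 0 < ε) (hδ : 0 < δ) (hn : 0 < n) (j : ℕ)
    {Λ : ℝ} (hΛ : 0 ≤ Λ) :
    (mapHom sumHom (baseShuffled ε δ n (2 ^ j) fun _ => 0)).toOuterMeasure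
      {z | 1.3 * (2 ^ j * (Λ / ε)) < (z : ℝ) * gridWidth ε n (2 ^ j)} ≤
      ENNReal.ofReal (Real.exp (-Λ)) := by
  have hV : 0 < 2 ^ j := by positivity
  have hΔ := gridSize_pos hε hn hV
  have hB := gridWidth_pos hε hn hV
  have hBΔ := gridWidth_mul_gridSize_le hε hn j
  rw [mapHom_sumHom_baseShuffled hε hδ hn hV]
  simp only [randRound_zero, ← one_def, Finset.prod_const_one, one_mul]
  generalize gridWidth ε n (2 ^ j) = B at *
  generalize gridSize ε n (2 ^ j) = Δ at *
  have hΔ' : (0 : ℝ) < Δ := by exact_mod_cast hΔ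
  have hB' : (0 : ℝ) < B := by exact_mod_cast hB
  have hset : {z : ℤ | 1.3 * (2 ^ j * (Λ / ε)) < (z : ℝ) * B} =
      {z : ℤ | 1.3 * (2 ^ j * (Λ / ε)) / B < (z : ℝ)} := by
    ext z
    simp only [Set.mem_ofPred_eq, div_lt_iff₀ hB']
  rw [hset]
  refine (central_noise_upper_tail hε hΔ _).trans (ENNReal.ofReal_le_ofReal ?_)
  refine Real.exp_le_exp.2 (neg_le_neg ?_)
  have : (1 - lam) * ε / Δ * (1.3 * (2 ^ j * (Λ / ε)) / B) = Λ * (1.17 * 2 ^ j / (B * Δ)) := by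
    rw [lam]
    field_simp
    norm_num
    ring
  rw [this]
  refine le_mul_of_one_le_right hΛ ?_
  rwa [one_le_div (by positivity)]

/-! ### The error of SumDP -/

/-- The messages with a given tag. -/
def untagHom (j : ℕ) : Multiset Msg →+ Multiset ℤ where
  toFun R := (R.filter fun m => m.1 = j).map Prod.snd
  map_zero' := rfl
  map_add' R S := by rw [Multiset.filter_add, Multiset.map_add]

theorem untagHom_tagHom (j k : ℕ) (S : Multiset ℤ) :
    untagHom j (tagHom k S) = if k = j then S else 0 := by
  change ((S.map fun y => (k, y)).filter fun m : Msg => m.1 = j).map Prod.snd = _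
  rw [Multiset.filter_map, Multiset.map_map]
  by_cases h : k = j <;> simp [h]

theorem map_untagHom_shuffled (ε δ : ℝ) (n U : ℕ) (D : Fin n → Fin (U + 1)) {j : ℕ}
    (hj : j ∈ Finset.range (Nat.log 2 U + 1)) :
    mapHom (untagHom j) (shuffled (sumRandomizer ε δ n U) D) =
      baseShuffled ε δ n (2 ^ j) fun i => part j (D i) := by
  rw [shuffled_sumRandomizer_eq, map_prod, Finset.prod_eq_single j]
  · rw [mapHom_apply, mapHom_apply, PMF.map_comp]
    have : (untagHom j ∘ tagHom j) = id := by
      funext S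
      simp [untagHom_tagHom]
    rw [this, PMF.map_id]
  · intro k _ hk
    rw [mapHom_apply, mapHom_apply, PMF.map_comp]
    exact map_eq_one _ fun S => by simp [untagHom_tagHom, hk]
  · exact fun h => absurd hj h

theorem toOuterMeasure_subEstimate (ε δ : ℝ) (n U : ℕ) (D : Fin n → Fin (U + 1)) {j : ℕ}
    (hj : j ∈ Finset.range (Nat.log 2 U + 1)) (A : Set ℝ) :
    (shuffled (sumRandomizer ε δ n U) D).toOuterMeasure {R | (subEstimate ε n R j : ℝ) ∈ A} =
      (mapHom sumHom (baseShuffled ε δ n (2 ^ j) fun i => part j (D i))).toOuterMeasure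
        {z | (z : ℝ) * gridWidth ε n (2 ^ j) ∈ A} := by
  rw [← map_untagHom_shuffled ε δ n U D hj, mapHom_apply, mapHom_apply, PMF.map_comp,
    PMF.toOuterMeasure_map_apply]
  congr 1
  ext R
  have h : (subEstimate ε n R j : ℝ) =
      ((sumHom (untagHom j R) : ℤ) : ℝ) * gridWidth ε n (2 ^ j) := by
    rw [subEstimate, baseAnalyzer, Int.cast_mul, Int.cast_natCast]
    rfl
  change (subEstimate ε n R j : ℝ) ∈ A ↔ _
  rw [h]
  rfl

theorem sum_part {u x : ℕ} (hx : x ≤ 2 ^ u) : ∑ j ∈ Finset.range (u + 1), part j x = x := by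
  rcases Nat.eq_zero_or_pos x with rfl | hx0
  · simp [part_zero]
  · rw [Finset.sum_eq_single (Nat.clog 2 x)]
    · rw [part, if_pos (inSubdomain_iff.2 ⟨hx0, rfl⟩)]
    · exact fun j _ hj => part_eq_zero_of_ne hj.symm
    · intro h
      rw [Finset.mem_range] at h
      have := Nat.clog_le_of_le_pow hx
      omega

theorem trueSum_eq {n u : ℕ} (D : Fin n → Fin (2 ^ u + 1)) :
    (trueSum D : ℝ) = ∑ j ∈ Finset.range (u + 1), ∑ i, (part j (D i) : ℝ) := by
  rw [Finset.sum_comm, trueSum]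
  push_cast
  refine Finset.sum_congr rfl fun i _ => ?_
  rw [← Nat.cast_sum, sum_part (by omega)]

/-- The effect of clipping: if the estimates are accurate up to the index `k`, if those above `k`
do not pass the test, and if there is nothing above `k`, then the clipped sum is accurate. -/
theorem clipped_sum_error {u k : ℕ} {g K : ℝ} (hg : 0 ≤ g) (hK : 0 ≤ K) (s est : ℕ → ℝ)
    (P : ℕ → Prop) [DecidablePred P] (hP : ∀ j, P j ↔ 1.3 * (2 ^ j * g) < est j)
    (hs : ∀ j, 0 ≤ s j) (hs0 : ∀ j, k < j → s j = 0)
    (hle : ∀ j ≤ u, j ≤ k → |est j - s j| ≤ K * (2 ^ j * g))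
    (hgt : ∀ j ≤ u, k < j → est j ≤ 1.3 * (2 ^ j * g)) (hk : k ≤ u) :
    |∑ j ∈ (Finset.range (u + 1)).filter (fun j => 2 ^ j ≤
        ((Finset.range (u + 1)).filter P).sup fun j => 2 ^ j), est j -
      ∑ j ∈ Finset.range (u + 1), s j| ≤ (K + 1.3) * (2 ^ (k + 1) * g) := by
  set τ := ((Finset.range (u + 1)).filter P).sup fun j => 2 ^ j with hτ
  have hτk : τ ≤ 2 ^ k := by
    refine Finset.sup_le fun j hj => ?_
    rw [Finset.mem_filter, Finset.mem_range, hP] at hj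
    refine Nat.pow_le_pow_right (by norm_num) ?_
    by_contra! hkj
    exact absurd hj.2 (not_lt.2 (hgt j (by omega) hkj))
  rw [Finset.sum_filter, ← Finset.sum_sub_distrib]
  refine (Finset.abs_sum_le_sum_abs _ _).trans ?_
  have hterm : ∀ j ∈ Finset.range (u + 1), |(if 2 ^ j ≤ τ then est j else 0) - s j| ≤
      if j ∈ Finset.range (k + 1) then (K + 1.3) * (2 ^ j * g) else 0 := by
    intro j hj
    rw [Finset.mem_range] at hj
    have h0 : 0 ≤ 2 ^ j * g := by positivity
    simp only [Finset.mem_range]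
    by_cases hjk : j < k + 1
    · rw [if_pos hjk]
      have h1 := hle j (by omega) (by omega)
      split_ifs with h2
      · exact h1.trans (by nlinarith)
      · have h3 : ¬ P j := fun hPj => h2 (Finset.le_sup (f := fun j => 2 ^ j)
          (Finset.mem_filter.2 ⟨Finset.mem_range.2 hj, hPj⟩))
        rw [hP, not_lt] at h3
        rw [zero_sub, abs_neg, abs_of_nonneg (hs j)]
        linarith [(abs_le.1 h1).1]
    · rw [if_neg hjk, hs0 j (by omega), if_neg]
      · simp
      · intro h
        have := (Nat.pow_le_pow_iff_right (by norm_num : 1 < 2)).1 (h.trans hτk)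
        omega
  refine (Finset.sum_le_sum hterm).trans ?_
  rw [← Finset.sum_filter, Finset.filter_mem_eq_inter]
  have h1 : Finset.range (u + 1) ∩ Finset.range (k + 1) = Finset.range (k + 1) := by
    ext j
    simp only [Finset.mem_inter, Finset.mem_range]
    omega
  rw [h1, ← Finset.mul_sum, ← Finset.sum_mul]
  have h2 : ∑ j ∈ Finset.range (k + 1), (2 : ℝ) ^ j ≤ 2 ^ (k + 1) := by
    rw [geom_sum_eq (by norm_num)]
    norm_num
  gcongr

theorem two_pow_clog_le {m : ℕ} (hm : 0 < m) : 2 ^ Nat.clog 2 m ≤ 2 * m := by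
  rcases (by omega : m = 1 ∨ 1 < m) with rfl | h
  · simp
  · have h1 := Nat.pow_pred_clog_lt_self (b := 2) (by norm_num) h
    have h2 := Nat.clog_pos (b := 2) (by norm_num) h
    obtain ⟨c, hc⟩ : ∃ c, Nat.clog 2 m = c + 1 := ⟨_, (Nat.succ_pred_eq_of_pos h2).symm⟩
    rw [hc, Nat.pred_succ] at h1
    rw [hc, pow_succ]
    omega

theorem one_le_lg (t : ℝ) : 1 ≤ lg t := le_max_left _ _

theorem log_le_lg {t : ℝ} : Real.log t ≤ Real.log 2 * lg t := by
  have h2 : 0 < Real.log 2 := Real.log_pos (by norm_num)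
  have h := le_max_right 1 (Real.logb 2 t)
  calc Real.log t = Real.log 2 * Real.logb 2 t := by rw [Real.logb]; field_simp
    _ ≤ _ := by gcongr; exact h

theorem logb_two_pow (u : ℕ) : Real.logb 2 ((2 ^ u : ℕ) : ℝ) = u := by
  push_cast
  rw [Real.logb_pow, Real.logb_self_eq_one (by norm_num), mul_one]

theorem lg_two_pow (u : ℕ) : lg ((2 ^ u : ℕ) : ℝ) = max 1 (u : ℝ) := by
  rw [lg, logb_two_pow]

theorem log_test_le {u : ℕ} {β : ℝ} (hβ : 0 < β) :
    Real.log (2 * (u + 1) / β) ≤ 3 * lg (lg ((2 ^ u : ℕ) : ℝ) / β) := by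
  have hl := one_le_lg ((2 ^ u : ℕ) : ℝ)
  have hu : (u : ℝ) ≤ lg ((2 ^ u : ℕ) : ℝ) := by
    rw [lg_two_pow]
    exact le_max_right _ _
  set t := lg ((2 ^ u : ℕ) : ℝ) / β with ht
  have ht0 : 0 < t := by positivity
  have h1 : 2 * ((u : ℝ) + 1) / β ≤ 2 ^ 2 * t := by
    rw [ht, ← mul_div_assoc]
    refine div_le_div_of_nonneg_right ?_ hβ.le
    linarith
  have h2 : Real.log (2 * (u + 1) / β) ≤ Real.log (2 ^ 2 * t) :=
    Real.log_le_log (by positivity) h1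
  rw [Real.log_mul (by positivity) ht0.ne', Real.log_pow] at h2
  push_cast at h2
  have h3 := log_le_lg (t := t)
  have h4 := one_le_lg t
  have h5 := Real.log_two_lt_d9
  have h6 := Real.log_two_gt_d9
  nlinarith

theorem sumDP_error {ε₀ ε δ β : ℝ} {n u : ℕ} (hε : 0 < ε) (hε₀ : ε ≤ ε₀) (hδ : 0 < δ)
    (hn : 0 < n) (hβ : 0 < β) (D : Fin n → Fin (2 ^ u + 1)) :
    ENNReal.ofReal (1 - β) ≤ (shuffled (sumRandomizer ε δ n (2 ^ u)) D).toOuterMeasure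
      {R | |(sumAnalyzer ε β n (2 ^ u) R : ℝ) - (trueSum D : ℝ)| ≤
        12 * (5 + 4 * ε₀) * ((maxElem D : ℝ) * lg (lg ((2 ^ u : ℕ) : ℝ) / β) / ε)} := by
  classical
  rcases le_or_gt 1 β with hβ1 | hβ1
  · rw [ENNReal.ofReal_of_nonpos (by linarith)]
    exact zero_le
  set m := maxElem D with hm
  set Λ := Real.log (2 * (u + 1) / β) with hΛ
  have hu0 : (0 : ℝ) ≤ u := by positivity
  have hexp : Real.exp (-Λ) = β / (2 * (u + 1)) := by
    rw [hΛ, Real.exp_neg, Real.exp_log (by positivity), inv_div]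
  have hΛ2 : Real.log 2 ≤ Λ := by
    refine Real.log_le_log (by norm_num) ?_
    rw [le_div_iff₀ hβ]
    nlinarith
  have hΛ0 : 0 ≤ Λ := (Real.log_nonneg (by norm_num)).trans hΛ2
  have hlog : Nat.log 2 (2 ^ u) = u := Nat.log_pow (by norm_num) u
  have hDm (i : Fin n) : (D i : ℕ) ≤ m := Finset.le_sup (f := fun i => (D i : ℕ)) (Finset.mem_univ i)
  have hmu : m ≤ 2 ^ u := Finset.sup_le fun i _ => by omega
  set p := shuffled (sumRandomizer ε δ n (2 ^ u)) D with hp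
  set s : ℕ → ℝ := fun j => ∑ i, (part j (D i) : ℝ) with hs
  set bad : ℕ → Set ℝ := fun j => if 0 < m ∧ j ≤ Nat.clog 2 m then
    {y | (3 + 4 * ε) * (2 ^ j * (Λ / ε)) < |y - s j|} else {y | 1.3 * (2 ^ j * (Λ / ε)) < y}
    with hbad
  have hs0 (j : ℕ) (hj : ¬ (0 < m ∧ j ≤ Nat.clog 2 m)) (i : Fin n) : part j (D i) = 0 := by
    by_cases hm0 : 0 < m
    · refine part_eq_zero_of_ne ?_
      have := Nat.clog_mono_right 2 (hDm i)
      have h2 : ¬ j ≤ Nat.clog 2 m := fun h => hj ⟨hm0, h⟩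
      omega
    · have : (D i : ℕ) = 0 := by
        have := hDm i
        omega
      rw [this, part_zero]
  have hprob : ∀ j ∈ Finset.range (u + 1),
      p.toOuterMeasure {R | (subEstimate ε n R j : ℝ) ∈ bad j} ≤ ENNReal.ofReal (β / (u + 1)) := by
    intro j hj
    have h2 : 2 * Real.exp (-Λ) = β / (u + 1) := by
      rw [hexp]
      field_simp
    rw [toOuterMeasure_subEstimate _ _ _ _ _ (by rwa [hlog]), ← h2]
    by_cases hc : 0 < m ∧ j ≤ Nat.clog 2 m
    · simp only [hbad, if_pos hc]
      exact base_error hε hδ hn j _ hΛ2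
    · simp only [hbad, if_neg hc, hs0 j hc]
      refine (base_zero_tail hε hδ hn j hΛ0).trans (ENNReal.ofReal_le_ofReal ?_)
      linarith [Real.exp_pos (-Λ)]
  set Bad : Set (Multiset Msg) := ⋃ j ∈ Finset.range (u + 1),
    {R | (subEstimate ε n R j : ℝ) ∈ bad j} with hBad
  have hBadp : p.toOuterMeasure Bad ≤ ENNReal.ofReal β := by
    refine (MeasureTheory.measure_biUnion_finset_le _ _).trans ((Finset.sum_le_sum hprob).trans ?_)
    rw [Finset.sum_const, Finset.card_range, nsmul_eq_mul, ← ENNReal.ofReal_natCast,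
      ← ENNReal.ofReal_mul (by positivity)]
    refine ENNReal.ofReal_le_ofReal (le_of_eq ?_)
    push_cast
    field_simp
  have hgood : ENNReal.ofReal (1 - β) ≤ p.toOuterMeasure Badᶜ := by
    have h1 := toOuterMeasure_compl p Bad
    rw [ENNReal.ofReal_sub _ hβ.le, ENNReal.ofReal_one, tsub_le_iff_left, ← h1]
    gcongr
  refine hgood.trans (MeasureTheory.measure_mono fun R hR => ?_)
  have hR' : ∀ j ≤ u, (subEstimate ε n R j : ℝ) ∉ bad j := by
    intro j hj hmem
    exact hR (Set.mem_biUnion (show j ∈ (Finset.range (u + 1) : Set ℕ) by simp; omega) hmem)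
  change |(sumAnalyzer ε β n (2 ^ u) R : ℝ) - (trueSum D : ℝ)| ≤ _
  have hP (j : ℕ) : ((subEstimate ε n R j : ℝ) >
      1.3 * 2 ^ j * Real.log (2 * (Real.logb 2 ((2 ^ u : ℕ) : ℝ) + 1) / β) / ε) ↔
      1.3 * (2 ^ j * (Λ / ε)) < (subEstimate ε n R j : ℝ) := by
    rw [logb_two_pow, ← hΛ, gt_iff_lt, mul_assoc, mul_div_assoc, mul_div_assoc]
  rw [trueSum_eq, sumAnalyzer, clipThreshold, hlog]
  rw [Int.cast_sum]
  by_cases hm0 : 0 < m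
  · set k := Nat.clog 2 m with hk
    have h1 := clipped_sum_error (u := u) (k := k) (g := Λ / ε) (K := 3 + 4 * ε) (by positivity)
      (by positivity) s (fun j => (subEstimate ε n R j : ℝ))
      (fun j => (subEstimate ε n R j : ℝ) >
        1.3 * 2 ^ j * Real.log (2 * (Real.logb 2 ((2 ^ u : ℕ) : ℝ) + 1) / β) / ε) hP
      (fun j => by positivity)
      (fun j hj => by
        simp only [hs]
        exact Finset.sum_eq_zero fun i _ => by rw [hs0 j (by omega) i, Nat.cast_zero])
      (fun j hj hjk => by
        have := hR' j hj
        simp only [hbad, if_pos (show 0 < m ∧ j ≤ k from ⟨hm0, hjk⟩), Set.mem_ofPred_eq,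
          not_lt] at this
        exact this)
      (fun j hj hjk => by
        have := hR' j hj
        simp only [hbad, if_neg (show ¬ (0 < m ∧ j ≤ k) by omega), Set.mem_ofPred_eq,
          not_lt] at this
        exact this)
      (Nat.clog_le_of_le_pow hmu)
    refine le_trans ?_ (h1.trans ?_)
    · convert le_rfl using 4
    · have h2 : (2 : ℝ) ^ (k + 1) ≤ 4 * m := by
        have := two_pow_clog_le hm0
        rw [← hk] at this
        have : (2 : ℝ) ^ k ≤ 2 * m := by exact_mod_cast this
        rw [pow_succ]
        linarith
      have h3 : Λ ≤ 3 * lg (lg ((2 ^ u : ℕ) : ℝ) / β) := log_test_le hβ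
      have h4 : 3 + 4 * ε + 1.3 ≤ 5 + 4 * ε₀ := by linarith
      calc (3 + 4 * ε + 1.3) * (2 ^ (k + 1) * (Λ / ε))
          ≤ (5 + 4 * ε₀) * (4 * m * (3 * lg (lg ((2 ^ u : ℕ) : ℝ) / β) / ε)) := by
            gcongr
            linarith
        _ = _ := by ring
  · have hpass : (Finset.range (u + 1)).filter (fun j => (subEstimate ε n R j : ℝ) >
        1.3 * 2 ^ j * Real.log (2 * (Real.logb 2 ((2 ^ u : ℕ) : ℝ) + 1) / β) / ε) = ∅ := by
      refine Finset.filter_eq_empty_iff.2 fun j hj => ?_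
      rw [hP]
      have := hR' j (by simpa [Nat.lt_succ_iff] using hj)
      simpa only [hbad, if_neg (show ¬ (0 < m ∧ j ≤ Nat.clog 2 m) from fun h => hm0 h.1),
        Set.mem_ofPred_eq] using this
    have hz : ∑ j ∈ Finset.range (u + 1), ∑ i, (part j (D i) : ℝ) = 0 :=
      Finset.sum_eq_zero fun j _ => Finset.sum_eq_zero fun i _ => by
        rw [hs0 j (fun h => hm0 h.1) i, Nat.cast_zero]
    have hm0' : m = 0 := by omega
    rw [hz, hm0']
    rw [hpass]
    simp

/-! ### The expected number of messages -/

theorem choose_succ_mul_left (r : ℝ) (k : ℕ) :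
    Ring.choose (r + (k + 1 : ℕ) - 1) (k + 1) * (k + 1) = r * Ring.choose (r + 1 + k - 1) k := by
  have h1 := factorial_mul_choose r (k + 1)
  rw [ascPochhammer_succ_left, Polynomial.eval_mul, Polynomial.eval_comp] at h1
  simp only [Polynomial.eval_X, Polynomial.eval_add, Polynomial.eval_one] at h1
  rw [← factorial_mul_choose (r + 1) k, Nat.factorial_succ] at h1
  have h2 : (k.factorial : ℝ) ≠ 0 := by positivity
  apply mul_left_cancel₀ h2
  push_cast at h1 ⊢
  linarith

theorem succ_mul_negBinomialReal {p : ℝ} (hp1 : p < 1) (r : ℝ) (k : ℕ) :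
    (k + 1) * negBinomialReal r p (k + 1) = r * p / (1 - p) * negBinomialReal (r + 1) p k := by
  have := choose_succ_mul_left r k
  have hp : 0 < 1 - p := by linarith
  rw [negBinomialReal, negBinomialReal, Real.rpow_add hp, Real.rpow_one, pow_succ,
    div_mul_eq_mul_div, eq_div_iff hp.ne']
  linear_combination (1 - p) ^ r * p ^ k * p * (1 - p) * this

theorem mean_negBinomial {r p : ℝ} (hr : 0 ≤ r) (hp0 : 0 ≤ p) (hp1 : p < 1) :
    ev (negBinomial r p) (fun k => (k : ℝ≥0∞)) = ENNReal.ofReal (r * p / (1 - p)) := by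
  have hp : 0 < 1 - p := by linarith
  rw [ev, tsum_eq_zero_add' ENNReal.summable, Nat.cast_zero, mul_zero, zero_add]
  have h (k : ℕ) : negBinomial r p (k + 1) * ((k + 1 : ℕ) : ℝ≥0∞) =
      ENNReal.ofReal (r * p / (1 - p)) * negBinomial (r + 1) p k := by
    rw [negBinomial_apply hr hp0 hp1, negBinomial_apply (by linarith) hp0 hp1,
      ← ENNReal.ofReal_natCast, ← ENNReal.ofReal_mul (negBinomialReal_nonneg hr hp0 hp1 _),
      ← ENNReal.ofReal_mul (by positivity), ← succ_mul_negBinomialReal hp1]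
    push_cast
    rw [mul_comm]
  simp only [h]
  rw [ENNReal.tsum_mul_left, PMF.tsum_coe, mul_one]

theorem mean_negBinomial_le {r a : ℝ} (hr : 0 ≤ r) (ha : 0 < a) :
    ev (negBinomial r (Real.exp (-a))) (fun k => (k : ℝ≥0∞)) ≤ ENNReal.ofReal (r / a) := by
  have hp1 : Real.exp (-a) < 1 := by simpa using ha
  rw [mean_negBinomial hr (Real.exp_pos _).le hp1]
  refine ENNReal.ofReal_le_ofReal ?_
  rw [div_le_div_iff₀ (by linarith) ha]
  have h1 := Real.add_one_le_exp a
  have h2 : Real.exp a * Real.exp (-a) = 1 := by rw [← Real.exp_add]; simp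
  have h3 : (a + 1) * Real.exp (-a) ≤ 1 :=
    (mul_le_mul_of_nonneg_right h1 (Real.exp_pos _).le).trans_eq h2
  nlinarith

/-- The number of messages, as a weight. -/
def cardWeight {α : Type} (S : Multiset α) : ℝ≥0∞ := (S.card : ℝ≥0∞)

theorem cardWeight_add {α : Type} (S T : Multiset α) :
    cardWeight (S + T) = cardWeight S + cardWeight T := by
  simp [cardWeight]

theorem expectedCard_eq_ev {α : Type} (p : PMF (Multiset α)) : expectedCard p = ev p cardWeight :=
  rfl

theorem ev_copies_cardWeight_le {r a : ℝ} (hr : 0 ≤ r) (ha : 0 < a) (s : Multiset ℤ) {c : ℕ}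
    (hs : s.card ≤ c) : ev (copies (negBinomial r (Real.exp (-a))) s) cardWeight ≤
      ENNReal.ofReal (r / a * c) := by
  rw [copies, ev_map]
  have h : ∀ k : ℕ, cardWeight (k • s) ≤ (c : ℝ≥0∞) * (k : ℝ≥0∞) := by
    intro k
    rw [cardWeight, Multiset.card_nsmul, mul_comm]
    push_cast
    gcongr
  refine (ev_mono _ h).trans ?_
  rw [ev_const_mul, mul_comm, ENNReal.ofReal_mul (by positivity), ENNReal.ofReal_natCast]
  gcongr
  exact mean_negBinomial_le hr ha

theorem card_zeroSumSet_le (w : ℤ) : (zeroSumSet w).card ≤ 3 := by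
  rw [zeroSumSet]
  split_ifs <;> simp

theorem sum_inv_leaders_le {Δ : ℕ} (hΔ : 0 < Δ) :
    ∑ w ∈ leaders Δ, (w.natAbs : ℝ)⁻¹ ≤ 2 * (1 + Real.log Δ) := by
  rw [sum_leaders hΔ]
  simp only [Int.natAbs_neg, Int.natAbs_natCast, ← two_mul, Int.natAbs_one]
  rw [← Finset.mul_sum]
  have h1 := harmonic_le_one_add_log Δ
  rw [harmonic_eq_sum_Icc] at h1
  push_cast at h1
  have h2 : Finset.Icc 1 Δ = insert 1 (Finset.Ico 2 (Δ + 1)) := by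
    ext v
    simp only [Finset.mem_Icc, Finset.mem_insert, Finset.mem_Ico]
    omega
  rw [h2, Finset.sum_insert (by simp)] at h1
  push_cast at h1 ⊢
  linarith

theorem noise_card_le {ε δ : ℝ} {n Δ : ℕ} (hε : 0 < ε) (hδ : 0 < δ) (hn : 0 < n) (hΔ : 0 < Δ) :
    ev (noise ε δ n Δ) cardWeight ≤ ENNReal.ofReal (3 * Δ / (ε * n) +
      600 * (floodShape δ Δ * Δ * (Nat.clog 2 Δ + 1) * (1 + Real.log Δ)) / (min 1 ε * n)) := by
  have hn' : (0 : ℝ) < n := by exact_mod_cast hn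
  have hΔ' : (0 : ℝ) < Δ := by exact_mod_cast hΔ
  have hm : 0 < min 1 ε := lt_min one_pos hε
  have hr := three_lt_floodShape hδ hΔ
  have hl : (0 : ℝ) < 1 - lam := by norm_num [lam]
  have hlog : 0 ≤ Real.log Δ := Real.log_natCast_nonneg Δ
  have hc (s : Multiset ℤ) (hs : s.card ≤ 1) :
      ev (copies (negBinomial (1 / n) (centralParam ε Δ)) s) cardWeight ≤
        ENNReal.ofReal (1.5 * Δ / (ε * n)) := by
    refine (ev_copies_cardWeight_le (a := (1 - lam) * ε / Δ) (by positivity) (by positivity) s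
      hs).trans (ENNReal.ofReal_le_ofReal ?_)
    rw [lam, show 1 / (n : ℝ) / ((1 - 0.1) * ε / Δ) * ((1 : ℕ) : ℝ) = (1 / 0.9) * Δ / (ε * n) by
      push_cast; field_simp; norm_num]
    gcongr
    norm_num
  have hf (w : ℤ) (hw : w ∈ leaders Δ) :
      ev (copies (negBinomial (floodShape δ Δ / n) (floodParam ε Δ w.natAbs)) (zeroSumSet w))
        cardWeight ≤ ENNReal.ofReal (300 * (floodShape δ Δ * Δ * (Nat.clog 2 Δ + 1)) /
          (min 1 ε * n) * (w.natAbs : ℝ)⁻¹) := by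
    have hw0 : (0 : ℝ) < w.natAbs := by exact_mod_cast natAbs_pos_of_mem_leaders hw
    refine (ev_copies_cardWeight_le (by positivity)
      (flood_rate_pos hε hΔ (natAbs_pos_of_mem_leaders hw)) _
      (card_zeroSumSet_le w)).trans (ENNReal.ofReal_le_ofReal (le_of_eq ?_))
    rw [lam]
    push_cast
    field_simp
    norm_num
  rw [noise_eq_noiseProd _ _ _ hΔ, noiseProd, ev_mul_of_additive _ _ cardWeight_add,
    ev_mul_of_additive _ _ cardWeight_add, ev_prod_of_additive _ _ (by simp [cardWeight])
    cardWeight_add]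
  refine (add_le_add (add_le_add (hc {1} (by simp)) (hc {-1} (by simp)))
    (Finset.sum_le_sum hf)).trans ?_
  rw [← ENNReal.ofReal_sum_of_nonneg (fun w _ => by positivity), ← Finset.mul_sum,
    ← ENNReal.ofReal_add (by positivity) (by positivity),
    ← ENNReal.ofReal_add (by positivity) (by positivity)]
  refine ENNReal.ofReal_le_ofReal ?_
  have h1 := sum_inv_leaders_le hΔ
  calc _ ≤ 1.5 * Δ / (ε * n) + 1.5 * Δ / (ε * n) + 300 * (floodShape δ Δ * Δ *
        (Nat.clog 2 Δ + 1)) / (min 1 ε * n) * (2 * (1 + Real.log Δ)) := by gcongr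
    _ = _ := by ring

theorem roundMsg_card_le (j x B : ℕ) :
    ev (roundMsg (part j x) B) cardWeight ≤ if j = Nat.clog 2 x then 1 else 0 := by
  split_ifs with h
  · rw [roundMsg, ev_map]
    refine ev_le_one _ fun y => ?_
    by_cases hy : y = 0 <;> simp [single, hy, cardWeight]
  · rw [part_eq_zero_of_ne (Ne.symm h), roundMsg, randRound_zero, ev_map, ev_pure]
    simp [single, cardWeight]

/-- A factor of `√n` in the bound for the size of the rounded domain. -/
def gridConst (ε₀ : ℝ) : ℝ := 11 * (1 + ε₀)

theorem gridCount_le {ε₀ ε : ℝ} {n : ℕ} (hε : 0 < ε) (hε₀ : ε ≤ ε₀) (hn : 0 < n) :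
    (⌈√((n : ℝ) / zeta ε)⌉₊ : ℝ) ≤ gridConst ε₀ * √n := by
  have hn1 : (1 : ℝ) ≤ n := by exact_mod_cast hn
  have hε₀' : 0 < ε₀ := hε.trans_le hε₀
  have hs : 1 ≤ √(n : ℝ) := Real.one_le_sqrt.2 hn1
  have h1 := (Nat.ceil_lt_add_one (Real.sqrt_nonneg ((n : ℝ) / zeta ε))).le
  have h2 : √((n : ℝ) / zeta ε) ≤ 10 * (1 + ε₀) * √n := by
    refine Real.sqrt_le_iff.2 ⟨by positivity, ?_⟩
    rw [mul_pow, Real.sq_sqrt (by linarith), div_le_iff₀ (zeta_pos hε)]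
    have h3 : 1 ≤ 10 * (1 + ε₀) * zeta ε := by
      rw [zeta]
      rcases min_choice (0.1 : ℝ) (0.1 / ε) with h | h <;> rw [h]
      · linarith
      · rw [← mul_div_assoc, one_le_div hε]
        linarith
    have h4 : 1 ≤ 10 * (1 + ε₀) := by linarith
    have h5 : 1 ≤ (10 * (1 + ε₀)) ^ 2 * zeta ε := by nlinarith
    nlinarith
  rw [gridConst]
  nlinarith

theorem clog_le_logb {m : ℕ} (hm : 0 < m) : (Nat.clog 2 m : ℝ) ≤ Real.logb 2 m + 1 := by
  have h := Real.natCeil_logb_natCast 2 m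
  have h1 : (1 : ℝ) ≤ m := by exact_mod_cast hm
  rw [← h]
  push_cast
  exact (Nat.ceil_lt_add_one (Real.logb_nonneg (by norm_num) h1)).le

theorem logb_le_self {c : ℝ} (hc : 0 < c) : Real.logb 2 c ≤ 2 * c := by
  have h := Real.log_le_sub_one_of_pos hc
  have h2 := Real.log_two_gt_d9
  rw [Real.logb, div_le_iff₀ (by linarith)]
  nlinarith

theorem log_le_logb {x : ℝ} (hx : 1 ≤ x) : Real.log x ≤ Real.logb 2 x := by
  have h := Real.log_nonneg hx
  have h2 := Real.log_two_lt_d9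
  have h3 := Real.log_two_gt_d9
  rw [Real.logb, le_div_iff₀ (by linarith)]
  nlinarith

theorem logb_le_lg (t : ℝ) : Real.logb 2 t ≤ lg t := le_max_right _ _

theorem lg_mono {s t : ℝ} (hs : 0 < s) (h : s ≤ t) : lg s ≤ lg t :=
  max_le_max le_rfl (Real.logb_le_logb_of_le (by norm_num) hs h)

theorem logb_le_of_le_mul_sqrt {c x : ℝ} {n : ℕ} (hc : 0 < c) (hn : 0 < n) (hx : 0 < x)
    (h : x ≤ c * √n) : Real.logb 2 x ≤ (2 * c + 1) * lg n := by
  have hn1 : (1 : ℝ) ≤ n := by exact_mod_cast hn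
  have hs : √(n : ℝ) ≤ n := Real.sqrt_le_iff.2 ⟨by linarith, by nlinarith⟩
  have h1 : Real.logb 2 x ≤ Real.logb 2 (c * n) :=
    Real.logb_le_logb_of_le (by norm_num) hx (h.trans (by gcongr))
  rw [Real.logb_mul hc.ne' (by linarith)] at h1
  have h2 := logb_le_self hc
  have h3 := one_le_lg n
  have h4 := logb_le_lg n
  nlinarith

/-- The constant in the bound for the expected number of noise messages. -/
def noiseConst (ε₀ : ℝ) : ℝ :=
  3 * gridConst ε₀ + 600 * (3 * (2 * gridConst ε₀ + 4) * gridConst ε₀ * (2 * gridConst ε₀ + 3) *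
    (2 * gridConst ε₀ + 2)) * (1 + ε₀)

theorem noise_card_asymptotic {ε₀ ε δ : ℝ} {n U : ℕ} (hε : 0 < ε) (hε₀ : ε ≤ ε₀) (hδ : 0 < δ)
    (hn : 0 < n) (hU : 0 < U) (hδn : δ ≤ 1 / n) :
    ev (noise ε δ n (gridSize ε n U)) cardWeight ≤
      ENNReal.ofReal (noiseConst ε₀ * (lg n ^ 2 * lg (1 / δ) / (ε * √n))) := by
  have hΔ := gridSize_pos hε hn hU
  refine (noise_card_le hε hδ hn hΔ).trans (ENNReal.ofReal_le_ofReal ?_)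
  have hn1 : (1 : ℝ) ≤ n := by exact_mod_cast hn
  have hn0 : (0 : ℝ) < n := by linarith
  have hε₀' : 0 < ε₀ := hε.trans_le hε₀
  set c := gridConst ε₀ with hc
  have hc0 : 0 < c := by rw [hc, gridConst]; positivity
  have hΔc : (gridSize ε n U : ℝ) ≤ c * √n :=
    le_trans (by exact_mod_cast gridSize_le_gridCount hε hn hU) (gridCount_le hε hε₀ hn)
  generalize gridSize ε n U = Δ at *
  have hΔ1 : (1 : ℝ) ≤ Δ := by exact_mod_cast hΔ
  have hr := three_lt_floodShape hδ hΔ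
  set a := lg n with ha
  set b := lg (1 / δ) with hb
  have ha1 : 1 ≤ a := one_le_lg _
  have hnδ : (n : ℝ) ≤ 1 / δ := by
    rw [le_div_iff₀ hδ]
    rw [le_div_iff₀ hn0] at hδn
    linarith
  have hab : a ≤ b := lg_mono hn0 hnδ
  have hlogb : Real.logb 2 Δ ≤ (2 * c + 1) * a :=
    logb_le_of_le_mul_sqrt hc0 hn (by linarith) hΔc
  have hlog : Real.log Δ ≤ (2 * c + 1) * a := (log_le_logb hΔ1).trans hlogb
  have hlog0 : 0 ≤ Real.log Δ := Real.log_nonneg hΔ1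
  have hclog : (Nat.clog 2 Δ : ℝ) + 1 ≤ (2 * c + 3) * a := by
    have := clog_le_logb hΔ
    linarith
  have hshape : floodShape δ Δ ≤ 3 * (2 * c + 4) * b := by
    have hδ1 : δ ≤ 1 := hδn.trans (by rw [div_le_one hn0]; exact hn1)
    have h1 : Real.log (1 / δ) ≤ b := (log_le_logb (hn1.trans hnδ)).trans (logb_le_lg _)
    have h2 := Real.log_two_lt_d9
    rw [floodShape, min_eq_left hδ1, mul_div_assoc, Real.log_mul (by norm_num) (by positivity),
      div_eq_mul_one_div, Real.log_mul (by linarith) (by positivity)]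
    have h3 : (2 * c + 1) * a ≤ (2 * c + 1) * b := by gcongr
    nlinarith
  have hmin : 1 / min 1 ε ≤ (1 + ε₀) / ε := by
    rw [div_le_div_iff₀ (lt_min one_pos hε) hε]
    rcases min_choice 1 ε with h | h <;> rw [h] <;> nlinarith
  have hs0 : 0 < √(n : ℝ) := Real.sqrt_pos.2 hn0
  have hsq : √(n : ℝ) * √n = n := Real.mul_self_sqrt hn0.le
  have hsn : √(n : ℝ) / n = 1 / √n := by rw [div_eq_div_iff hn0.ne' hs0.ne']; linarith
  have hab1 : 1 ≤ a ^ 2 * b := by nlinarith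
  have hb0 : 0 < b := by linarith
  have e1 : 3 * (Δ : ℝ) / (ε * n) ≤ 3 * c * (a ^ 2 * b / (ε * √n)) := by
    calc 3 * (Δ : ℝ) / (ε * n) ≤ 3 * (c * √n) / (ε * n) := by gcongr
      _ = 3 * c * (1 / ε) * (√n / n) := by field_simp
      _ = 3 * c * (1 / (ε * √n)) := by rw [hsn]; field_simp
      _ ≤ _ := by gcongr
  have e2 : 600 * (floodShape δ Δ * Δ * (Nat.clog 2 Δ + 1) * (1 + Real.log Δ)) / (min 1 ε * n) ≤
      600 * (3 * (2 * c + 4) * c * (2 * c + 3) * (2 * c + 2)) * (1 + ε₀) *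
        (a ^ 2 * b / (ε * √n)) := by
    calc _ = 600 * (floodShape δ Δ * Δ * (Nat.clog 2 Δ + 1) * (1 + Real.log Δ)) *
          (1 / min 1 ε) * (1 / n) := by field_simp
      _ ≤ 600 * ((3 * (2 * c + 4) * b) * (c * √n) * ((2 * c + 3) * a) * ((2 * c + 2) * a)) *
          ((1 + ε₀) / ε) * (1 / n) := by
        gcongr
        linarith
      _ = 600 * (3 * (2 * c + 4) * c * (2 * c + 3) * (2 * c + 2)) * (1 + ε₀) * (a ^ 2 * b / ε) *
          (√n / n) := by ring
      _ = _ := by rw [hsn]; field_simp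
  rw [noiseConst, ← hc, add_mul]
  exact add_le_add e1 e2

theorem expectedCard_le {ε₀ ε δ : ℝ} {n u : ℕ} (hε : 0 < ε) (hε₀ : ε ≤ ε₀) (hδ : 0 < δ)
    (hn : 0 < n) (hδn : δ ≤ 1 / n) (x : Fin (2 ^ u + 1)) :
    expectedCard (sumRandomizer ε δ n (2 ^ u) x) ≤
      ENNReal.ofReal (1 + 2 * noiseConst ε₀ *
        (lg ((2 ^ u : ℕ) : ℝ) * lg n ^ 2 * lg (1 / δ) / (ε * √n))) := by
  set Q := lg n ^ 2 * lg (1 / δ) / (ε * √n) with hQ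
  have hε₀' : 0 < ε₀ := hε.trans_le hε₀
  have hlgn := one_le_lg n
  have hlgδ := one_le_lg (1 / δ)
  have hQ0 : 0 ≤ Q := by positivity
  have hC : 0 ≤ noiseConst ε₀ := by rw [noiseConst, gridConst]; positivity
  have hlog : Nat.log 2 (2 ^ u) = u := Nat.log_pow (by norm_num) u
  rw [expectedCard_eq_ev, sumRandomizer_eq, ev_prod_of_additive _ _ (by simp [cardWeight])
    cardWeight_add, hlog]
  have hterm : ∀ j ∈ Finset.range (u + 1),
      ev (mapHom (tagHom j) (baseRandomizer ε δ n (2 ^ j) (part j x))) cardWeight ≤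
        (if j = Nat.clog 2 x then 1 else 0) + ENNReal.ofReal (noiseConst ε₀ * Q) := by
    intro j _
    have h1 : ∀ S, cardWeight (tagHom j S) = cardWeight S := fun S => by
      simp [cardWeight, tagHom]
    rw [mapHom_apply, ev_map]
    simp only [h1]
    rw [baseRandomizer_eq]
    refine (ev_mul_of_additive _ _ cardWeight_add).trans_le ?_
    exact add_le_add (roundMsg_card_le _ _ _)
      (noise_card_asymptotic hε hε₀ hδ hn (by positivity) hδn)
  refine (Finset.sum_le_sum hterm).trans ?_
  rw [Finset.sum_add_distrib, Finset.sum_const, Finset.card_range, nsmul_eq_mul,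
    ENNReal.ofReal_add zero_le_one (by
      have := one_le_lg ((2 ^ u : ℕ) : ℝ)
      positivity), ENNReal.ofReal_one, ← ENNReal.ofReal_natCast, ← ENNReal.ofReal_mul (by positivity)]
  refine add_le_add ?_ (ENNReal.ofReal_le_ofReal ?_)
  · rw [Finset.sum_ite_eq']
    split_ifs <;> simp
  · have h2 : ((u + 1 : ℕ) : ℝ) ≤ 2 * lg ((2 ^ u : ℕ) : ℝ) := by
      rw [lg_two_pow]
      push_cast
      linarith [le_max_left 1 (u : ℝ), le_max_right 1 (u : ℝ)]
    calc ((u + 1 : ℕ) : ℝ) * (noiseConst ε₀ * Q)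
        ≤ 2 * lg ((2 ^ u : ℕ) : ℝ) * (noiseConst ε₀ * Q) := by gcongr
      _ = _ := by rw [hQ]; ring

/-! ### The length of the messages -/

section Support

variable {M : Type} [AddCommMonoid M]

theorem support_mul_subset {p q : PMF M} {A : AddSubmonoid M} (hp : p.support ⊆ A)
    (hq : q.support ⊆ A) : (p * q).support ⊆ A := by
  intro a ha
  rw [mul_def, PMF.mem_support_bind_iff] at ha
  obtain ⟨b, hb, hab⟩ := ha
  obtain ⟨c, hc, rfl⟩ := (PMF.mem_support_map_iff _ _ _).1 hab
  exact A.add_mem (hp hb) (hq hc)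

theorem support_prod_subset {ι : Type*} (s : Finset ι) {p : ι → PMF M} {A : AddSubmonoid M}
    (h : ∀ i ∈ s, (p i).support ⊆ A) : (∏ i ∈ s, p i).support ⊆ A := by
  classical
  induction s using Finset.induction_on with
  | empty => simp [one_def]
  | insert i s hi ih =>
    rw [Finset.prod_insert hi]
    exact support_mul_subset (h i (Finset.mem_insert_self i s))
      (ih fun j hj => h j (Finset.mem_insert_of_mem hj))

end Support

/-- The multisets all of whose elements belong to a given set. -/
def multisetsOver {α : Type} (P : Set α) : AddSubmonoid (Multiset α) where
  carrier := {S | ∀ a ∈ S, a ∈ P}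
  zero_mem' := by simp
  add_mem' := by
    intro S T hS hT a ha
    rcases Multiset.mem_add.1 ha with h | h
    · exact hS a h
    · exact hT a h

theorem mem_multisetsOver {α : Type} {P : Set α} {S : Multiset α} :
    S ∈ multisetsOver P ↔ ∀ a ∈ S, a ∈ P := Iff.rfl

theorem support_copies_subset (q : PMF ℕ) {s : Multiset ℤ} {A : AddSubmonoid (Multiset ℤ)}
    (hs : s ∈ A) : (copies q s).support ⊆ A := by
  intro S hS
  obtain ⟨k, -, rfl⟩ := (PMF.mem_support_map_iff _ _ _).1 hS
  exact A.nsmul_mem hs k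

theorem zeroSumSet_bounded {Δ : ℕ} {w : ℤ} (hw : w ∈ leaders Δ) :
    zeroSumSet w ∈ multisetsOver {y : ℤ | |y| ≤ (Δ : ℤ)} := by
  rw [mem_leaders] at hw
  rw [mem_multisetsOver, zeroSumSet]
  split_ifs with h
  · subst h
    intro y hy
    simp only [Multiset.insert_eq_cons, Multiset.mem_cons, Multiset.mem_singleton] at hy
    change |y| ≤ Δ
    rcases hy with rfl | rfl <;> simpa using hw.1
  · intro y hy
    simp only [Multiset.insert_eq_cons, Multiset.mem_cons, Multiset.mem_singleton] at hy
    change |y| ≤ Δ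
    have hsign : |w.sign| ≤ 1 := by
      rcases Int.sign_trichotomy w with h | h | h <;> simp [h]
    have hnat : (w.natAbs : ℤ) ≤ Δ := by
      rw [Int.natCast_natAbs]
      exact hw.1
    have key (k : ℕ) (hk : k ≤ w.natAbs) : |-(w.sign * (k : ℤ))| ≤ Δ := by
      rw [abs_neg, abs_mul, Nat.abs_cast]
      have : |w.sign| * (k : ℤ) ≤ 1 * k := by gcongr
      omega
    rcases hy with rfl | rfl | rfl
    · exact hw.1
    · exact key _ (by have := Int.natAbs_eq_zero (a := w); omega)
    · exact key _ (by omega)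

theorem noise_bounded {ε δ : ℝ} {n Δ : ℕ} (hΔ : 0 < Δ) :
    (noise ε δ n Δ).support ⊆ multisetsOver {y : ℤ | |y| ≤ (Δ : ℤ)} := by
  rw [noise_eq_noiseProd _ _ _ hΔ, noiseProd]
  have h1 : (1 : ℤ) ≤ Δ := by exact_mod_cast hΔ
  refine support_mul_subset (support_mul_subset (support_copies_subset _ ?_)
    (support_copies_subset _ ?_)) (support_prod_subset _ fun w hw =>
      support_copies_subset _ (zeroSumSet_bounded hw))
  · simpa [mem_multisetsOver] using h1
  · simpa [mem_multisetsOver] using h1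

theorem baseRandomizer_bounded {ε δ : ℝ} {n U x : ℕ} (hε : 0 < ε) (hn : 0 < n) (hU : 0 < U)
    (hx : x ≤ U) : (baseRandomizer ε δ n U x).support ⊆
      multisetsOver {y : ℤ | |y| ≤ (gridSize ε n U : ℤ)} := by
  rw [baseRandomizer_eq]
  refine support_mul_subset ?_ (noise_bounded (gridSize_pos hε hn hU))
  intro S hS
  obtain ⟨y, hy, rfl⟩ := (PMF.mem_support_map_iff _ _ _).1 hS
  obtain ⟨h0, h1⟩ := randRound_range hx hy
  change single y ∈ multisetsOver _
  rw [mem_multisetsOver, single]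
  split_ifs
  · simp
  · intro a ha
    rw [Multiset.mem_singleton.1 ha]
    change |y| ≤ _
    rw [abs_of_nonneg h0]
    exact h1

theorem gridSize_le {ε : ℝ} {n U : ℕ} (hε : 0 < ε) (hn : 0 < n) (hU : 0 < U) :
    gridSize ε n U ≤ U := by
  have hB : (1 : ℝ) ≤ gridWidth ε n U := by exact_mod_cast gridWidth_pos hε hn hU
  rw [gridSize, Nat.ceil_le]
  exact div_le_self (by positivity) hB

theorem sendable_bounded {ε δ : ℝ} {n u : ℕ} (hε : 0 < ε) (hn : 0 < n) {m : Msg}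
    (hm : m ∈ sendable ε δ n (2 ^ u)) :
    m.1 ≤ u ∧ |m.2| ≤ (min (2 ^ u) ⌈√((n : ℝ) / zeta ε)⌉₊ : ℕ) := by
  obtain ⟨x, S, hS, hmS⟩ := hm
  have hlog : Nat.log 2 (2 ^ u) = u := Nat.log_pow (by norm_num) u
  rw [sumRandomizer_eq, hlog] at hS
  have hsub := support_prod_subset (A := multisetsOver {m : Msg | m.1 ≤ u ∧
    |m.2| ≤ (min (2 ^ u) ⌈√((n : ℝ) / zeta ε)⌉₊ : ℕ)}) (Finset.range (u + 1))
    (p := fun j => mapHom (tagHom j) (baseRandomizer ε δ n (2 ^ j) (part j x))) (by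
      intro j hj S hS
      rw [Finset.mem_range] at hj
      obtain ⟨T, hT, rfl⟩ := (PMF.mem_support_map_iff _ _ _).1 hS
      have hV : 0 < 2 ^ j := by positivity
      have hT' := baseRandomizer_bounded hε hn hV (part_le j x) hT
      intro m hm
      obtain ⟨y, hy, rfl⟩ := Multiset.mem_map.1 hm
      have hy' : |y| ≤ (gridSize ε n (2 ^ j) : ℤ) := hT' y hy
      refine ⟨by omega, hy'.trans ?_⟩
      have h1 := gridSize_le hε hn hV
      have h2 := gridSize_le_gridCount hε hn hV
      have h3 : 2 ^ j ≤ 2 ^ u := Nat.pow_le_pow_right (by norm_num) (by omega)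
      exact_mod_cast le_min (h1.trans h3) h2)
  exact hsub hS m hmS

theorem eq_of_testBit_eq_of_lt {k a b : ℕ} (ha : a < 2 ^ k) (hb : b < 2 ^ k)
    (h : (fun i : Fin k => a.testBit i) = fun i : Fin k => b.testBit i) : a = b := by
  refine Nat.eq_of_testBit_eq fun i => ?_
  by_cases hi : i < k
  · exact congrFun h ⟨i, hi⟩
  · have hk : 2 ^ k ≤ 2 ^ i := Nat.pow_le_pow_right (by norm_num) (by omega)
    rw [Nat.testBit_lt_two_pow (ha.trans_le hk), Nat.testBit_lt_two_pow (hb.trans_le hk)]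

theorem lg_le_self {t : ℝ} (ht : 1 ≤ t) : lg t ≤ t := by
  refine max_le ht ?_
  rw [Real.logb_le_iff_le_rpow (by norm_num) (by linarith)]
  have h := one_add_mul_self_le_rpow_one_add (s := 1) (by norm_num) ht
  norm_num at h
  linarith

theorem exists_code {ε₀ ε δ : ℝ} {n u : ℕ} (hε : 0 < ε) (hε₀ : ε ≤ ε₀) (hn : 0 < n) :
    ∃ (k₀ k₁ : ℕ) (tagCode : ℕ → Fin k₀ → Bool) (valCode : ℤ → Fin k₁ → Bool),
      Set.InjOn (fun m : Msg => (tagCode m.1, valCode m.2)) (sendable ε δ n (2 ^ u)) ∧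
      (k₁ : ℝ) ≤ (2 * gridConst ε₀ + 4) * min (lg n) (lg ((2 ^ u : ℕ) : ℝ)) ∧
      (k₀ : ℝ) ≤ 3 * lg (lg ((2 ^ u : ℕ) : ℝ)) ∧
      (Real.logb 2 ((2 ^ u : ℕ) : ℝ) ≤ n → ((k₀ + k₁ : ℕ) : ℝ) ≤
        (2 * gridConst ε₀ + 7) * min (lg n) (lg ((2 ^ u : ℕ) : ℝ))) := by
  have hε₀' : 0 < ε₀ := hε.trans_le hε₀
  set G := ⌈√((n : ℝ) / zeta ε)⌉₊ with hG
  set K := min (2 ^ u) G with hK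
  have hG0 : 0 < G := gridCount_pos hε hn
  have hK0 : 0 < K := lt_min (by positivity) hG0
  have hc0 : 0 < gridConst ε₀ := by rw [gridConst]; positivity
  have hlgn := one_le_lg n
  have hlgU := one_le_lg ((2 ^ u : ℕ) : ℝ)
  have hu : (u : ℝ) ≤ lg ((2 ^ u : ℕ) : ℝ) := by rw [lg_two_pow]; exact le_max_right _ _
  have hk₁ : (Nat.clog 2 (2 * K + 1) : ℝ) ≤
      (2 * gridConst ε₀ + 4) * min (lg n) (lg ((2 ^ u : ℕ) : ℝ)) := by
    have hc4 : 0 ≤ 2 * gridConst ε₀ + 4 := by positivity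
    rw [mul_min_of_nonneg _ _ hc4]
    refine le_min ?_ ?_
    · have h1 : Nat.clog 2 (2 * K + 1) ≤ Nat.clog 2 G + 2 := by
        refine Nat.clog_le_of_le_pow ?_
        have := Nat.le_pow_clog (b := 2) (by norm_num) G
        have h2 : K ≤ G := min_le_right _ _
        rw [pow_add]
        omega
      have h2 := clog_le_logb hG0
      have h3 := logb_le_of_le_mul_sqrt hc0 hn (by exact_mod_cast hG0) (gridCount_le hε hε₀ hn)
      have h4 : (Nat.clog 2 (2 * K + 1) : ℝ) ≤ Nat.clog 2 G + 2 := by exact_mod_cast h1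
      linarith
    · have h1 : Nat.clog 2 (2 * K + 1) ≤ u + 2 := by
        refine Nat.clog_le_of_le_pow ?_
        have h2 : K ≤ 2 ^ u := min_le_left _ _
        rw [pow_add]
        omega
      have h4 : (Nat.clog 2 (2 * K + 1) : ℝ) ≤ u + 2 := by exact_mod_cast h1
      nlinarith
  have hk₀ : (Nat.clog 2 (u + 1) : ℝ) ≤ 3 * lg (lg ((2 ^ u : ℕ) : ℝ)) := by
    have h1 := clog_le_logb (m := u + 1) (by omega)
    have h2 : Real.logb 2 ((u + 1 : ℕ) : ℝ) ≤ Real.logb 2 (2 * lg ((2 ^ u : ℕ) : ℝ)) := by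
      refine Real.logb_le_logb_of_le (by norm_num) (by positivity) ?_
      push_cast at hu hlgU ⊢
      linarith
    rw [Real.logb_mul (by norm_num) (by positivity), Real.logb_self_eq_one (by norm_num)] at h2
    have h3 := logb_le_lg (lg ((2 ^ u : ℕ) : ℝ))
    have h4 := one_le_lg (lg ((2 ^ u : ℕ) : ℝ))
    linarith
  refine ⟨Nat.clog 2 (u + 1), Nat.clog 2 (2 * K + 1), fun t i => t.testBit i,
    fun y i => (y + K).toNat.testBit i, ?_, hk₁, hk₀, ?_⟩
  · rintro ⟨t, y⟩ hm ⟨t', y'⟩ hm' h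
    obtain ⟨h1, h2⟩ := sendable_bounded hε hn hm
    obtain ⟨h1', h2'⟩ := sendable_bounded hε hn hm'
    obtain ⟨e1, e2⟩ := Prod.mk.inj h
    rw [← hG, ← hK, abs_le] at h2 h2'
    have b1 := Nat.le_pow_clog (b := 2) (by norm_num) (u + 1)
    have b2 := Nat.le_pow_clog (b := 2) (by norm_num) (2 * K + 1)
    have ht : t = t' := eq_of_testBit_eq_of_lt (by simp only at h1; omega)
      (by simp only at h1'; omega) e1
    have hy : (y + K).toNat = (y' + K).toNat :=
      eq_of_testBit_eq_of_lt (by simp only at h2; omega) (by simp only at h2'; omega) e2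
    simp only at h2 h2'
    rw [ht, show y = y' by omega]
  · intro hun
    rw [logb_two_pow] at hun
    have hn1 : (1 : ℝ) ≤ n := by exact_mod_cast hn
    have h1 : lg (lg ((2 ^ u : ℕ) : ℝ)) ≤ min (lg n) (lg ((2 ^ u : ℕ) : ℝ)) := by
      refine le_min (lg_mono (by positivity) ?_) (lg_le_self hlgU)
      rw [lg_two_pow]
      exact max_le hn1 hun
    rw [Nat.cast_add]
    linarith

end ShuffleSum

end

open ShuffleSum in
theorem mainTheorem1 :
    -- privacy of the messages received by the analyzer
    (∀ (ε δ : ℝ) (n U : ℕ), 0 < ε → 0 < δ → 0 < n → (∃ u : ℕ, U = 2 ^ u) →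
      IsDP (AddRemove (n := n) (U := U)) ε δ (shuffled (sumRandomizer ε δ n U)) ∧
      IsDP (Replace (n := n) (U := U)) (2 * ε) (2 * δ) (shuffled (sumRandomizer ε δ n U))) ∧
    -- error and communication, with a constant that depends only on an upper bound for `ε`
    (∀ ε₀ : ℝ, 0 < ε₀ → ∃ C : ℝ, 0 < C ∧
      ∀ (ε δ : ℝ) (n U : ℕ), 0 < ε → ε ≤ ε₀ → 0 < δ → 0 < n → (∃ u : ℕ, U = 2 ^ u) →
        (∀ β : ℝ, 0 < β → ∀ D : Fin n → Fin (U + 1),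
          ENNReal.ofReal (1 - β) ≤
            (shuffled (sumRandomizer ε δ n U) D).toOuterMeasure
              {R | |(sumAnalyzer ε β n U R : ℝ) - (trueSum D : ℝ)| ≤
                C * ((maxElem D : ℝ) * lg (lg U / β) / ε)}) ∧
        (δ ≤ 1 / (n : ℝ) → ∀ x : Fin (U + 1),
          expectedCard (sumRandomizer ε δ n U x) ≤
            ENNReal.ofReal (1 + C * (lg U * lg n ^ 2 * lg (1 / δ) / (ε * √(n : ℝ))))) ∧
        (∃ (k₀ k₁ : ℕ) (tagCode : ℕ → Fin k₀ → Bool) (valCode : ℤ → Fin k₁ → Bool),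
          Set.InjOn (fun m : Msg => (tagCode m.1, valCode m.2)) (sendable ε δ n U) ∧
          (k₁ : ℝ) ≤ C * min (lg n) (lg U) ∧
          (k₀ : ℝ) ≤ C * lg (lg U) ∧
          (Real.logb 2 U ≤ n → ((k₀ + k₁ : ℕ) : ℝ) ≤ C * min (lg n) (lg U)))) := by
  refine ⟨fun ε δ n U hε hδ hn _ => ⟨isDP_addRemove hε hδ hn, isDP_replace hε hδ hn⟩,
    fun ε₀ hε₀ => ?_⟩
  have hc : 0 < gridConst ε₀ := by rw [gridConst]; positivity
  have hN : 0 < noiseConst ε₀ := by rw [noiseConst]; positivity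
  set C := 12 * (5 + 4 * ε₀) + 2 * noiseConst ε₀ + (2 * gridConst ε₀ + 7) with hC
  refine ⟨C, by positivity, ?_⟩
  rintro ε δ n _ hε hεε₀ hδ hn ⟨u, rfl⟩
  have hlgU := one_le_lg ((2 ^ u : ℕ) : ℝ)
  have hlgn := one_le_lg n
  refine ⟨fun β hβ D => ?_, fun hδn x => ?_, ?_⟩
  · refine (sumDP_error hε hεε₀ hδ hn hβ D).trans (MeasureTheory.measure_mono fun R hR => ?_)
    rw [Set.mem_ofPred_eq] at hR ⊢
    refine hR.trans ?_
    have := one_le_lg (lg ((2 ^ u : ℕ) : ℝ) / β)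
    gcongr
    linarith
  · refine (expectedCard_le hε hεε₀ hδ hn hδn x).trans (ENNReal.ofReal_le_ofReal ?_)
    have := one_le_lg (1 / δ)
    gcongr
    linarith
  · obtain ⟨k₀, k₁, tagCode, valCode, hinj, h₁, h₀, h₀₁⟩ := exists_code (δ := δ) (u := u) hε hεε₀ hn
    have hmin : 0 ≤ min (lg n) (lg ((2 ^ u : ℕ) : ℝ)) := le_min (by linarith) (by linarith)
    have hlg := one_le_lg (lg ((2 ^ u : ℕ) : ℝ))
    refine ⟨k₀, k₁, tagCode, valCode, hinj, h₁.trans ?_, h₀.trans ?_, fun h => (h₀₁ h).trans ?_⟩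
    · gcongr
      linarith
    · gcongr
      linarith
    · gcongr
      linarith
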